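/- Theorem 2 (Fibration theorem). Let $M$ be a connected smooth manifold (Hausdorff, second countable), let $\mathcal F$ be a smooth foliation of codimension $q$ on $M$, and let $G$ be a Lie group of dimension $q$ acting smoothly on $M$ (on the left) such that (i) all $G$-orbits have dimension $q$ and are transverse to the leaves of $\mathcal F$, and (ii) every $g\in G$ maps leaves of $\mathcal F$ onto leaves of $\mathcal F$. For a leaf $L$ put $H(L)=\{g\in G:\ g\cdot l\in L \text{ for every (equivalently, for some) } l\in L\}$, a subgroup of $G$. Let $L$ be endowed with its leaf topology and its smooth structure as a leaf, and let $G\times_{H(L)}L$ be the orbit space of the action $h\cdot(g,l)=(gh^{-1},h\cdot l)$ of $H(L)$ on $G\times L$. Then for every leaf $L$ of $\mathcal F$ the following are equivalent: (a) some leaf of $\mathcal F$ is closed in $M$; (a$'$) $L$ is closed in $M$; (b) $H(L)$ is a closed discrete subgroup of $G$; (c) the projection $G\times L\to G$ onto the first factor induces a smooth fibration $M\simeq G\times_{H(L)}L\to G/H(L)$ whose fibres are the leaves of $\mathcal F$. That is: $G/H(L)$, with the quotient topology, is a (Hausdorff, second countable) smooth manifold of dimension $q$ such that $G\to G/H(L)$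 is a smooth submersion; $G\times_{H(L)}L$, with the quotient topology, is a smooth manifold such that $G\times L\to G\times_{H(L)}L$ is a local diffeomorphism; the map $G\times_{H(L)}L\to M$, $[g,l]\mapsto g\cdot l$, is a diffeomorphism; and the resulting map $M\to G/H(L)$, $g\cdot l\mapsto gH(L)$, is a smooth locally trivial fibre bundle with typical fibre $L$, whose fibres are exactly the leaves of $\mathcal F$. -/

import Mathlib

open scoped Manifold ContDiff Topology

/-- The model space `ℝⁿ`. -/
abbrev RSpace (n : ℕ) : Type := EuclideanSpace ℝ (Fin n)

/-- A smooth foliation of leaf dimension `p` and codimension `q` on a smooth manifold `M` of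
dimension `p + q`, given by a foliated atlas: smooth charts of `M` with values in `ℝᵖ × ℝ^q`, whose
images are products of an open connected set and an open set, and whose changes of coordinates are
locally of the form `(a, b) ↦ (h₁ (a, b), h₂ b)`. -/
structure Foliation (p q : ℕ) (M : Type*) [TopologicalSpace M]
    [ChartedSpace (RSpace (p + q)) M] where
  /-- The foliated charts. -/
  charts : Set (OpenPartialHomeomorph M (RSpace p × RSpace q))
  contMDiffOn_chart : ∀ φ ∈ charts,
    ContMDiffOn 𝓘(ℝ, RSpace (p + q)) 𝓘(ℝ, RSpace p × RSpace q) ∞ φ φ.source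
  contMDiffOn_chart_symm : ∀ φ ∈ charts,
    ContMDiffOn 𝓘(ℝ, RSpace p × RSpace q) 𝓘(ℝ, RSpace (p + q)) ∞ φ.symm φ.target
  target_eq_prod : ∀ φ ∈ charts, ∃ (A : Set (RSpace p)) (B : Set (RSpace q)),
    IsOpen A ∧ IsPreconnected A ∧ IsOpen B ∧ φ.target = A ×ˢ B
  cover : ∀ x : M, ∃ φ ∈ charts, x ∈ φ.source
  compatible : ∀ φ ∈ charts, ∀ ψ ∈ charts, ∀ x ∈ φ.source ∩ ψ.source,
    ∃ h : RSpace q → RSpace q, ∀ᶠ y in 𝓝 x, (ψ y).2 = h (φ y).2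

/-- The tangent space at `x` to the `G`-orbit of `x`: the image of the differential at `1` of the
orbit map `g ↦ g • x`. -/
noncomputable def orbitTangent (p q : ℕ) {M : Type*} [TopologicalSpace M]
    [ChartedSpace (RSpace (p + q)) M] (G : Type*) [Group G] [TopologicalSpace G]
    [ChartedSpace (RSpace q) G] [MulAction G M] (x : M) :
    Submodule ℝ (TangentSpace 𝓘(ℝ, RSpace (p + q)) ((1 : G) • x)) :=
  (mfderiv 𝓘(ℝ, RSpace q) 𝓘(ℝ, RSpace (p + q)) (fun g : G => g • x) 1).range

namespace Foliation

section Leaves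

variable {p q : ℕ} {M : Type*} [TopologicalSpace M] [ChartedSpace (RSpace (p + q)) M]
  (F : Foliation p q M)

/-- Two points lie in a common plaque, i.e. in a slice `b = const` of some foliated chart. -/
def SamePlaque (x y : M) : Prop :=
  ∃ φ ∈ F.charts, x ∈ φ.source ∧ y ∈ φ.source ∧ (φ x).2 = (φ y).2

/-- The leaf through `x`: all points which can be reached from `x` by a chain of plaques. -/
def leaf (x : M) : Set M := {y | Relation.EqvGen F.SamePlaque x y}

/-- The set of all leaves. -/
def leaves : Set (Set M) := Set.range F.leaf

variable {F} in
theorem mem_leaf_self (x : M) : x ∈ F.leaf x := Relation.EqvGen.refl x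

variable {F} in
theorem leaf_eq_of_mem {x y : M} (h : y ∈ F.leaf x) : F.leaf y = F.leaf x := by
  ext z
  exact ⟨fun hz => Relation.EqvGen.trans _ _ _ h hz,
    fun hz => Relation.EqvGen.trans _ _ _ (Relation.EqvGen.symm _ _ h) hz⟩

variable {F} in
theorem mem_leaf_of_samePlaque {x y z : M} (hy : y ∈ F.leaf x) (h : F.SamePlaque y z) :
    z ∈ F.leaf x :=
  Relation.EqvGen.trans _ _ _ hy (Relation.EqvGen.rel _ _ h)

variable {F} in
theorem samePlaque_chart_symm {φ : OpenPartialHomeomorph M (RSpace p × RSpace q)} (hφ : φ ∈ F.charts)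
    {x : M} (hx : x ∈ φ.source) {a : RSpace p} (ha : (a, (φ x).2) ∈ φ.target) :
    F.SamePlaque x (φ.symm (a, (φ x).2)) :=
  ⟨φ, hφ, hx, φ.map_target ha, by rw [φ.right_inv ha]⟩

/-- A chosen foliated chart around `x`. -/
noncomputable def someChart (x : M) : OpenPartialHomeomorph M (RSpace p × RSpace q) :=
  (F.cover x).choose

theorem someChart_mem (x : M) : F.someChart x ∈ F.charts := (F.cover x).choose_spec.1

theorem mem_someChart_source (x : M) : x ∈ (F.someChart x).source := (F.cover x).choose_spec.2

/-- The tangent space at `x` to the leaf through `x`, as a subspace of `T_x M`: the vectors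
annihilated by the differential of the transverse coordinate. -/
noncomputable def tangent (x : M) : Submodule ℝ (TangentSpace 𝓘(ℝ, RSpace (p + q)) x) :=
  (mfderiv 𝓘(ℝ, RSpace (p + q)) 𝓘(ℝ, RSpace q) (fun y => (F.someChart x y).2) x).ker

/-- The leaf through `x` as a space of its own. It carries the leaf topology, not the subspace
topology of `M`. -/
def Leaf (x : M) : Type _ := F.leaf x

namespace Leaf

variable {F} {x : M}

/-- The inclusion of a leaf in the ambient manifold. -/
def val (l : F.Leaf x) : M := Subtype.val l

theorem val_injective : Function.Injective (val : F.Leaf x → M) := Subtype.val_injective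

theorem val_mem (l : F.Leaf x) : l.val ∈ F.leaf x := Subtype.property l

/-- A point of the leaf, as an element of the type `F.Leaf x`. -/
def mk (y : M) (hy : y ∈ F.leaf x) : F.Leaf x := ⟨y, hy⟩

@[simp] theorem val_mk (y : M) (hy : y ∈ F.leaf x) : (mk y hy).val = y := rfl

@[simp] theorem mk_val (l : F.Leaf x) : mk l.val l.val_mem = l := rfl

/-- The leaf topology: a set is open if its trace on every plaque is open in that plaque, where
the plaque `φ.symm (·, c)` carries the topology of `ℝᵖ`. -/
instance : TopologicalSpace (F.Leaf x) where
  IsOpen V := ∀ φ ∈ F.charts, ∀ c : RSpace q,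
    IsOpen {a : RSpace p | (a, c) ∈ φ.target ∧ ∃ l ∈ V, l.val = φ.symm (a, c)}
  isOpen_univ := by
    intro φ hφ c
    rw [isOpen_iff_mem_nhds]
    rintro a ⟨ha, l, -, hl⟩
    have hopen : IsOpen {a : RSpace p | (a, c) ∈ φ.target} :=
      φ.open_target.preimage (by fun_prop)
    filter_upwards [hopen.mem_nhds ha] with b hb
    refine ⟨hb, mk (φ.symm (b, c)) (mem_leaf_of_samePlaque l.val_mem ⟨φ, hφ, ?_, ?_, ?_⟩),
      trivial, rfl⟩
    · rw [hl]; exact φ.map_target ha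
    · exact φ.map_target hb
    · rw [hl, φ.right_inv ha, φ.right_inv hb]
  isOpen_inter := by
    intro U V hU hV φ hφ c
    convert (hU φ hφ c).inter (hV φ hφ c) using 1
    ext a
    constructor
    · rintro ⟨ha, l, ⟨hlU, hlV⟩, hl⟩
      exact ⟨⟨ha, l, hlU, hl⟩, ⟨ha, l, hlV, hl⟩⟩
    · rintro ⟨⟨ha, l, hlU, hl⟩, ⟨-, l', hlV, hl'⟩⟩
      obtain rfl : l = l' := val_injective (hl.trans hl'.symm)
      exact ⟨ha, l, ⟨hlU, hlV⟩, hl⟩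
  isOpen_sUnion := by
    intro S hS φ hφ c
    have : {a : RSpace p | (a, c) ∈ φ.target ∧ ∃ l ∈ ⋃₀ S, l.val = φ.symm (a, c)} =
        ⋃ V ∈ S, {a : RSpace p | (a, c) ∈ φ.target ∧ ∃ l ∈ V, l.val = φ.symm (a, c)} := by
      ext a
      simp only [Set.mem_sUnion, Set.mem_ofPred_eq, Set.mem_iUnion, exists_prop]
      constructor
      · rintro ⟨ha, l, ⟨V, hV, hlV⟩, hl⟩
        exact ⟨V, hV, ha, l, hlV, hl⟩
      · rintro ⟨V, hV, ha, l, hlV, hl⟩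
        exact ⟨ha, l, ⟨V, hV, hlV⟩, hl⟩
    rw [this]
    exact isOpen_biUnion fun V hV => hS V hV φ hφ c

theorem isOpen_iff {V : Set (F.Leaf x)} : IsOpen V ↔ ∀ φ ∈ F.charts, ∀ c : RSpace q,
    IsOpen {a : RSpace p | (a, c) ∈ φ.target ∧ ∃ l ∈ V, l.val = φ.symm (a, c)} := Iff.rfl

/-- Plaques, and their intersections with open sets of `M`, are open in the leaf topology. -/
theorem isOpen_plaque {φ : OpenPartialHomeomorph M (RSpace p × RSpace q)} (hφ : φ ∈ F.charts)
    (c : RSpace q) {U : Set M} (hU : IsOpen U) :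
    IsOpen {l : F.Leaf x | l.val ∈ φ.source ∧ (φ l.val).2 = c ∧ l.val ∈ U} := by
  rw [isOpen_iff]
  intro ψ hψ d
  rw [isOpen_iff_mem_nhds]
  rintro a ⟨ha, l, ⟨hl1, hl2, hl3⟩, hl⟩
  have hsrc : ψ.symm (a, d) ∈ ψ.source := ψ.map_target ha
  obtain ⟨h, hh⟩ := F.compatible ψ hψ φ hφ l.val ⟨by rw [hl]; exact hsrc, hl1⟩
  have hcont : ContinuousAt (fun b : RSpace p => ψ.symm (b, d)) a :=
    ContinuousAt.comp (f := fun b : RSpace p => (b, d)) (g := ψ.symm)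
      (ψ.continuousAt_symm ha) (by fun_prop)
  have hopen : IsOpen {b : RSpace p | (b, d) ∈ ψ.target} :=
    ψ.open_target.preimage (by fun_prop)
  have e0 : (φ l.val).2 = h d := by
    have := hh.self_of_nhds
    rwa [hl, ψ.right_inv ha, ← hl] at this
  rw [hl] at hh hl1 hl3
  filter_upwards [hopen.mem_nhds ha, hcont.eventually hh,
    hcont.eventually (φ.open_source.mem_nhds hl1), hcont.eventually (hU.mem_nhds hl3)]
    with b hb hb1 hb2 hb3
  refine ⟨hb, mk (ψ.symm (b, d)) (mem_leaf_of_samePlaque l.val_mem ⟨ψ, hψ, ?_, ?_, ?_⟩),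
    ⟨hb2, ?_, hb3⟩, rfl⟩
  · rw [hl]; exact hsrc
  · exact ψ.map_target hb
  · rw [hl, ψ.right_inv ha, ψ.right_inv hb]
  · rw [val_mk, hb1, ψ.right_inv hb, ← e0, hl2]

/-- The inclusion of a leaf is continuous for the leaf topology. -/
theorem continuous_val : Continuous (val : F.Leaf x → M) := by
  rw [continuous_def]
  intro U hU
  rw [isOpen_iff_mem_nhds]
  intro l hl
  exact Filter.mem_of_superset ((isOpen_plaque (F.someChart_mem l.val) _ hU).mem_nhds
    ⟨F.mem_someChart_source l.val, rfl, hl⟩) fun _ h => h.2.2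

/-- The chart of a leaf given by the plaque through `l₀` of a foliated chart `φ`: it maps a point
of the plaque to its leaf coordinate. -/
noncomputable def plaqueChart (φ : OpenPartialHomeomorph M (RSpace p × RSpace q))
    (hφ : φ ∈ F.charts) (l₀ : F.Leaf x) (h₀ : l₀.val ∈ φ.source) :
    OpenPartialHomeomorph (F.Leaf x) (RSpace p) where
  toFun l := (φ l.val).1
  invFun a := by
    classical
    exact if ha : (a, (φ l₀.val).2) ∈ φ.target then
      mk (φ.symm (a, (φ l₀.val).2)) (mem_leaf_of_samePlaque l₀.val_mem
        (samePlaque_chart_symm hφ h₀ ha))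
      else l₀
  source := {l | l.val ∈ φ.source ∧ (φ l.val).2 = (φ l₀.val).2}
  target := {a | (a, (φ l₀.val).2) ∈ φ.target}
  map_source' := by
    rintro l ⟨hl, hl2⟩
    change ((φ l.val).1, (φ l₀.val).2) ∈ φ.target
    rw [← hl2]
    exact φ.map_source hl
  map_target' := by
    intro a ha
    have ha' : (a, (φ l₀.val).2) ∈ φ.target := ha
    simp only [dif_pos ha', Set.mem_ofPred_eq, val_mk]
    exact ⟨φ.map_target ha', by rw [φ.right_inv ha']⟩
  left_inv' := by
    rintro l ⟨hl, hl2⟩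
    have ha' : ((φ l.val).1, (φ l₀.val).2) ∈ φ.target := by
      rw [← hl2]
      exact φ.map_source hl
    simp only [dif_pos ha']
    apply val_injective
    rw [val_mk, ← hl2]
    exact φ.left_inv hl
  right_inv' := by
    intro a ha
    have ha' : (a, (φ l₀.val).2) ∈ φ.target := ha
    simp only [dif_pos ha', val_mk, φ.right_inv ha']
  open_source := by simpa using isOpen_plaque hφ (φ l₀.val).2 isOpen_univ
  open_target := φ.open_target.preimage (by fun_prop)
  continuousOn_toFun := by
    refine (continuous_fst.comp_continuousOn φ.continuousOn).comp continuous_val.continuousOn ?_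
    exact fun l hl => hl.1
  continuousOn_invFun := by
    have hopen : IsOpen {a : RSpace p | (a, (φ l₀.val).2) ∈ φ.target} :=
      φ.open_target.preimage (by fun_prop)
    refine (continuousOn_open_iff hopen).2 ?_
    intro V hV
    convert isOpen_iff.1 hV φ hφ (φ l₀.val).2 using 1
    ext a
    constructor
    · rintro ⟨ha, haV⟩
      have ha' : (a, (φ l₀.val).2) ∈ φ.target := ha
      rw [Set.mem_preimage, dif_pos ha'] at haV
      exact ⟨ha', _, haV, rfl⟩
    · rintro ⟨ha, l, hlV, hl⟩
      refine ⟨ha, ?_⟩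
      rw [Set.mem_preimage, dif_pos ha]
      convert hlV
      exact val_injective hl.symm

/-- The leaf as a `p`-dimensional manifold, with the plaque charts as atlas. -/
noncomputable instance : ChartedSpace (RSpace p) (F.Leaf x) where
  atlas := {e | ∃ (φ : OpenPartialHomeomorph M (RSpace p × RSpace q)) (hφ : φ ∈ F.charts)
    (l₀ : F.Leaf x) (h₀ : l₀.val ∈ φ.source), e = plaqueChart φ hφ l₀ h₀}
  chartAt l := plaqueChart (F.someChart l.val) (F.someChart_mem l.val) l
    (F.mem_someChart_source l.val)
  mem_chart_source l := ⟨F.mem_someChart_source l.val, rfl⟩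
  chart_mem_atlas l := ⟨_, F.someChart_mem l.val, l, F.mem_someChart_source l.val, rfl⟩

/-- The plaque charts are smoothly compatible. -/
instance [IsManifold 𝓘(ℝ, RSpace (p + q)) ∞ M] : IsManifold 𝓘(ℝ, RSpace p) ∞ (F.Leaf x) := by
  apply isManifold_of_contDiffOn
  rintro _ _ ⟨φ, hφ, l₀, h₀, rfl⟩ ⟨ψ, hψ, l₁, h₁, rfl⟩
  have key : ContDiffOn ℝ ∞ (fun a : RSpace p => (ψ (φ.symm (a, (φ l₀.val).2))).1)
      {a | (a, (φ l₀.val).2) ∈ φ.target ∧ φ.symm (a, (φ l₀.val).2) ∈ ψ.source} := by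
    have h1 := (F.contMDiffOn_chart ψ hψ).comp' (F.contMDiffOn_chart_symm φ hφ)
    have h2 : ContDiffOn ℝ ∞ (ψ ∘ φ.symm) (φ.target ∩ φ.symm ⁻¹' ψ.source) :=
      contMDiffOn_iff_contDiffOn.1 h1
    exact contDiff_fst.comp_contDiffOn
      (h2.comp (contDiff_id.prodMk contDiff_const).contDiffOn fun a ha => ha)
  refine (key.mono ?_).congr ?_
  · rintro a ⟨⟨ha, ha'⟩, -⟩
    have ha1 : (a, (φ l₀.val).2) ∈ φ.target := ha
    have ha2 := ha'.1
    refine ⟨ha1, ?_⟩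
    simpa [plaqueChart, dif_pos ha1] using ha2
  · rintro a ⟨⟨ha, -⟩, -⟩
    have ha1 : (a, (φ l₀.val).2) ∈ φ.target := ha
    simp [plaqueChart, dif_pos ha1]

end Leaf

end Leaves

section Action

variable {p q : ℕ} {M : Type*} [TopologicalSpace M] [ChartedSpace (RSpace (p + q)) M]
  (F : Foliation p q M)
  (G : Type*) [Group G] [TopologicalSpace G] [ChartedSpace (RSpace q) G] [MulAction G M]

/-- The foliation `F`, of codimension `q = dim G`, is invariant under the transverse action of `G`
on `M`: the orbits have dimension `q` and are transverse to the leaves, and every group element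
maps leaves onto leaves. -/
structure IsInvariantTransverse : Prop where
  finrank_orbit : ∀ x : M, Module.finrank ℝ (orbitTangent p q G x) = q
  transverse : ∀ x : M, F.tangent ((1 : G) • x) ⊔ orbitTangent p q G x = ⊤
  map_leaf : ∀ g : G, ∀ L ∈ F.leaves, (fun y => g • y) '' L ∈ F.leaves

variable {F G}

theorem IsInvariantTransverse.image_leaf (hF : F.IsInvariantTransverse G) (g : G) (y : M) :
    (fun z => g • z) '' F.leaf y = F.leaf (g • y) := by
  obtain ⟨z, hz⟩ := hF.map_leaf g (F.leaf y) ⟨y, rfl⟩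
  have : g • y ∈ F.leaf z := by
    rw [hz]
    exact ⟨y, mem_leaf_self y, rfl⟩
  rw [← hz, leaf_eq_of_mem this]

variable (hF : F.IsInvariantTransverse G) (x : M)

/-- The group `H(L)` of the leaf `L` through `x`: all `g ∈ G` with `g • l ∈ L` for every `l ∈ L`. -/
def leafGroup : Subgroup G where
  carrier := {g | ∀ l ∈ F.leaf x, g • l ∈ F.leaf x}
  one_mem' := by
    intro l hl
    simpa using hl
  mul_mem' := by
    intro a b ha hb l hl
    rw [mul_smul]
    exact ha _ (hb l hl)
  inv_mem' := by
    intro g hg l hl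
    have h1 : F.leaf (g • x) = F.leaf x := leaf_eq_of_mem (hg x (mem_leaf_self x))
    rw [← h1, ← hF.image_leaf] at hl
    obtain ⟨l', hl', rfl⟩ := hl
    simpa using hl'

/-- Equivalently, `H(L)` is the set of all `g ∈ G` with `g • l ∈ L` for some `l ∈ L`. -/
theorem mem_leafGroup_iff_exists (g : G) :
    g ∈ leafGroup hF x ↔ ∃ l ∈ F.leaf x, g • l ∈ F.leaf x := by
  constructor
  · intro hg
    exact ⟨x, mem_leaf_self x, hg x (mem_leaf_self x)⟩
  · rintro ⟨l, hl, hgl⟩ l' hl'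
    rw [← leaf_eq_of_mem hgl, ← hF.image_leaf, leaf_eq_of_mem hl]
    exact ⟨l', hl', rfl⟩

/-- The orbit relation on `G × L` of the action of `H = H(L)` in which `h` maps `(g, l)` to
`(g h⁻¹, h • l)`. -/
def twistedSetoid : Setoid (G × F.Leaf x) where
  r a b := ∃ h ∈ leafGroup hF x, b.1 = a.1 * h⁻¹ ∧ b.2.val = h • a.2.val
  iseqv :=
    { refl := fun a => ⟨1, one_mem _, by simp, by simp⟩
      symm := by
        rintro a b ⟨h, hh, h1, h2⟩
        exact ⟨h⁻¹, inv_mem hh, by simp [h1], by simp [h2]⟩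
      trans := by
        rintro a b c ⟨h, hh, h1, h2⟩ ⟨k, hk, k1, k2⟩
        exact ⟨k * h, mul_mem hk hh, by simp [h1, k1, mul_assoc], by simp [h2, k2, mul_smul]⟩ }

/-- The orbit space `G ×_H L`, with the quotient topology (`L` carries the leaf topology). -/
abbrev TwistedProduct : Type _ := Quotient (twistedSetoid hF x)

/-- The map `G ×_H L → M` induced by the action `(g, l) ↦ g • l`. -/
def twistedToManifold : TwistedProduct hF x → M :=
  Quotient.lift (fun a : G × F.Leaf x => a.1 • a.2.val) (by
    rintro a b ⟨h, -, h1, h2⟩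
    simp [h1, h2, mul_smul])

/-- The map `G ×_H L → G ⧸ H` induced by the projection of `G × L` onto the first factor. -/
def twistedProj : TwistedProduct hF x → G ⧸ leafGroup hF x :=
  Quotient.lift (fun a : G × F.Leaf x => (a.1 : G ⧸ leafGroup hF x)) (by
    rintro a b ⟨h, hh, h1, -⟩
    rw [QuotientGroup.eq, h1]
    simpa using hh)

end Action

end Foliation

/-- `π : X → B` is a smooth fibre bundle with typical fibre `Y`: it is smooth, and over a
neighbourhood of every point of `B` there is a smooth local trivialization with smooth inverse. -/
def IsSmoothFibreBundle {d e k : ℕ} {X B : Type*} (Y : Type*)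
    [TopologicalSpace X] [ChartedSpace (RSpace d) X]
    [TopologicalSpace B] [ChartedSpace (RSpace k) B]
    [TopologicalSpace Y] [ChartedSpace (RSpace e) Y] (π : X → B) : Prop :=
  ContMDiff 𝓘(ℝ, RSpace d) 𝓘(ℝ, RSpace k) ∞ π ∧
  ∀ b : B, ∃ τ : Bundle.Trivialization Y π, b ∈ τ.baseSet ∧
    ContMDiffOn 𝓘(ℝ, RSpace d) (𝓘(ℝ, RSpace k).prod 𝓘(ℝ, RSpace e)) ∞
      τ.toOpenPartialHomeomorph τ.source ∧
    ContMDiffOn (𝓘(ℝ, RSpace k).prod 𝓘(ℝ, RSpace e)) 𝓘(ℝ, RSpace d) ∞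
      τ.toOpenPartialHomeomorph.symm τ.target

namespace Foliation

/-- The projection `G × L → G` induces a smooth fibration `M ≃ G ×_H L → G ⧸ H` whose fibres are
the leaves. That is: `G ⧸ H` is a smooth manifold (with the smooth structure for which `G → G ⧸ H`
is a submersion), `G ×_H L` is a smooth manifold (with the smooth structure for which
`G × L → G ×_H L` is a local diffeomorphism), the map `G ×_H L → M` is a diffeomorphism `Ψ`, and
the composition of its inverse with `G ×_H L → G ⧸ H` is a smooth fibre bundle with typical fibre
`L`, the fibres of which are exactly the leaves. -/
def InducesFibration {p q : ℕ} {M : Type*} [TopologicalSpace M]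
    [ChartedSpace (RSpace (p + q)) M] {F : Foliation p q M}
    {G : Type*} [Group G] [TopologicalSpace G] [ChartedSpace (RSpace q) G] [MulAction G M]
    (hF : F.IsInvariantTransverse G) (x : M) : Prop :=
  ∃ (_ : ChartedSpace (RSpace q) (G ⧸ leafGroup hF x))
    (_ : ChartedSpace (RSpace (p + q)) (TwistedProduct hF x)),
    T2Space (G ⧸ leafGroup hF x) ∧
    SecondCountableTopology (G ⧸ leafGroup hF x) ∧
    IsManifold 𝓘(ℝ, RSpace q) ∞ (G ⧸ leafGroup hF x) ∧
    ContMDiff 𝓘(ℝ, RSpace q) 𝓘(ℝ, RSpace q) ∞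
      (fun g : G => (g : G ⧸ leafGroup hF x)) ∧
    (∀ g : G, Function.Surjective (mfderiv 𝓘(ℝ, RSpace q) 𝓘(ℝ, RSpace q)
      (fun g : G => (g : G ⧸ leafGroup hF x)) g)) ∧
    IsManifold 𝓘(ℝ, RSpace (p + q)) ∞ (TwistedProduct hF x) ∧
    IsLocalDiffeomorph (𝓘(ℝ, RSpace q).prod 𝓘(ℝ, RSpace p)) 𝓘(ℝ, RSpace (p + q)) ∞
      (fun a : G × F.Leaf x => (Quotient.mk (twistedSetoid hF x) a : TwistedProduct hF x)) ∧
    ∃ Ψ : TwistedProduct hF x ≃ₘ^∞⟮𝓘(ℝ, RSpace (p + q)), 𝓘(ℝ, RSpace (p + q))⟯ M,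
      ⇑Ψ = twistedToManifold hF x ∧
      IsSmoothFibreBundle (d := p + q) (e := p) (k := q) (F.Leaf x)
        (fun y : M => twistedProj hF x (Ψ.symm y)) ∧
      Set.range (fun b => (fun y : M => twistedProj hF x (Ψ.symm y)) ⁻¹' {b}) = F.leaves

end Foliation

/-! Everything rests on the action map `leafAction`, (g, l) ↦ g • l from G × L to M. At (1, l) its
differential is the sum of the orbit differential and the differential of the leaf inclusion.
Transversality and the count q + p make this bijective, and equivariance carries this to every (g,
l), so the map is a local diffeomorphism (`isLocalDiffeomorph_leafAction`). Its image is open. The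
images belonging to two leaves coincide or are disjoint, so connectedness of M makes it surjective
(`surjective_leafAction`). Two pairs have the same image exactly when they lie in one H(L)-orbit, so
G ×_H L is diffeomorphic to M whether or not L is closed. Surjectivity also shows that G permutes
the leaves transitively by homeomorphisms, so one leaf is closed if and only if all are.

If L is closed, then H(L) is closed, being the preimage of L under an orbit map. A leaf meets a
foliated chart in countably many plaques (`countable_transverse_leaf`), while near 1 the transverse
coordinate of g • x is a local coordinate on G. Hence H(L) is countable near 1, and Baire's theorem
makes it discrete (`discreteTopology_leafGroup`).

If H(L) is closed and discrete, then G → G/H is a local homeomorphism onto a Hausdorff space,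
through which the smooth structure of G descends. A local section s of it trivializes M → G/H by (b,
l) ↦ s(b) • l (`isSmoothFibreBundle_of_leafAction`). Conversely, the fibres of a continuous map to a
Hausdorff space are closed, so a fibration forces the leaves to be closed. -/

/-! ### Inverse function theorem and local diffeomorphisms -/

/-- The inverse function theorem, giving a partial homeomorphism with smooth inverse. -/
theorem ContDiffOn.exists_openPartialHomeomorph {E E' : Type*} [NormedAddCommGroup E]
    [NormedSpace ℝ E] [CompleteSpace E] [NormedAddCommGroup E'] [NormedSpace ℝ E']
    {f : E → E'} {U : Set E} (hU : IsOpen U)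
    (hf : ContDiffOn ℝ ∞ f U) {x : E} (hx : x ∈ U) (e : E ≃L[ℝ] E')
    (he : (e : E →L[ℝ] E') = fderiv ℝ f x) :
    ∃ Φ : OpenPartialHomeomorph E E', x ∈ Φ.source ∧ Φ.source ⊆ U ∧ Set.EqOn f Φ Φ.source ∧
      ContDiffOn ℝ ∞ Φ.symm Φ.target := by
  have hfx : ContDiffAt ℝ ∞ f x := hf.contDiffAt (hU.mem_nhds hx)
  have hd : HasFDerivAt f (e : E →L[ℝ] E') x := by
    rw [he]
    exact (hfx.differentiableAt (by simp)).hasFDerivAt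
  let Φ₀ := hfx.toOpenPartialHomeomorph f hd (by simp)
  have hx₀ : x ∈ Φ₀.source := hfx.mem_toOpenPartialHomeomorph_source hd (by simp)
  have hΦ₀ : (Φ₀ : E → E') = f := hfx.toOpenPartialHomeomorph_coe hd (by simp)
  -- Invertibility of the derivative is an open condition; restricting to this set makes the inverse
  -- smooth on its whole domain, not only at the image of `x`.
  have hW : IsOpen (U ∩ fderiv ℝ f ⁻¹' (Set.range ((↑) : (E ≃L[ℝ] E') → E →L[ℝ] E'))) :=
    (hf.continuousOn_fderiv_of_isOpen hU (by simp)).isOpen_inter_preimage hU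
      ContinuousLinearEquiv.isOpen
  refine ⟨Φ₀.restrOpen _ hW, ⟨hx₀, hx, e, he⟩, fun y hy => hy.2.1, fun y _ => ?_, fun y hy => ?_⟩
  · exact congrFun hΦ₀.symm y
  · have hy' := (Φ₀.restrOpen _ hW).map_target hy
    obtain ⟨hy1, hy2, e', hye'⟩ := hy'
    have hs : ContDiffAt ℝ ∞ f (Φ₀.symm y) := hf.contDiffAt (hU.mem_nhds hy2)
    refine (OpenPartialHomeomorph.contDiffAt_symm (Φ₀.restrOpen _ hW) (f₀' := e') hy
      ?_ ?_).contDiffWithinAt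
    · change HasFDerivAt Φ₀ _ (Φ₀.symm y)
      rw [hΦ₀, hye']
      exact (hs.differentiableAt (by simp)).hasFDerivAt
    · change ContDiffAt ℝ ∞ Φ₀ (Φ₀.symm y)
      rw [hΦ₀]
      exact hs

section LocalDiffeo

variable {E : Type*} [NormedAddCommGroup E] [NormedSpace ℝ E]
  {E' : Type*} [NormedAddCommGroup E'] [NormedSpace ℝ E']
  {H : Type*} [TopologicalSpace H] {H' : Type*} [TopologicalSpace H']
  {I : ModelWithCorners ℝ E H} {J : ModelWithCorners ℝ E' H'}
  {X : Type*} [TopologicalSpace X] [ChartedSpace H X]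
  {Y : Type*} [TopologicalSpace Y] [ChartedSpace H' Y]

/-- The extended chart of a manifold without boundary, as a partial diffeomorphism. -/
noncomputable def extChartDiffeo (I : ModelWithCorners ℝ E H) [I.Boundaryless]
    [IsManifold I ∞ X] (x : X) : PartialDiffeomorph I 𝓘(ℝ, E) X E ∞ where
  toPartialEquiv := extChartAt I x
  open_source := isOpen_extChartAt_source x
  open_target := isOpen_extChartAt_target x
  contMDiffOn_toFun := contMDiffOn_extChartAt.congr_mono (fun _ _ => rfl)
    (extChartAt_source I x).subset
  contMDiffOn_invFun := contMDiffOn_extChartAt_symm x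

/-- The inverse function theorem on manifolds without boundary. -/
theorem isLocalDiffeomorphAt_of_bijective_mfderiv [CompleteSpace E] [CompleteSpace E']
    [I.Boundaryless] [J.Boundaryless]
    [IsManifold I ∞ X] [IsManifold J ∞ Y] {f : X → Y} {U : Set X} (hU : IsOpen U)
    (hf : ContMDiffOn I J ∞ f U) {x : X} (hx : x ∈ U)
    (hb : Function.Bijective (mfderiv I J f x)) : IsLocalDiffeomorphAt I J ∞ f x := by
  have hfx : ContMDiffAt I J ∞ f x := hf.contMDiffAt (hU.mem_nhds hx)
  have hmd : MDifferentiableAt I J f x := hfx.mdifferentiableAt (by simp)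
  set c := extChartDiffeo (X := X) I x
  set d := extChartDiffeo (X := Y) J (f x)
  let fh : E → E' := fun u => d (f (c.symm u))
  have hxc : x ∈ c.source := mem_extChartAt_source x
  have hcx : c.symm (c x) = x := c.left_inv hxc
  have hUW : IsOpen (U ∩ f ⁻¹' d.source) := hf.continuousOn.isOpen_inter_preimage hU d.open_source
  have hV : IsOpen (c.target ∩ c.symm ⁻¹' (U ∩ f ⁻¹' d.source)) :=
    c.symm.contMDiffOn.continuousOn.isOpen_inter_preimage c.open_target hUW
  have hfh : ContDiffOn ℝ ∞ fh (c.target ∩ c.symm ⁻¹' (U ∩ f ⁻¹' d.source)) := by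
    rw [← contMDiffOn_iff_contDiffOn]
    refine d.contMDiffOn.comp (hf.comp (c.symm.contMDiffOn.mono ?_) ?_) ?_
    · exact fun u hu => hu.1
    · exact fun u hu => hu.2.1
    · exact fun u hu => hu.2.2
  have hcV : c x ∈ c.target ∩ c.symm ⁻¹' (U ∩ f ⁻¹' d.source) := by
    refine ⟨c.map_source hxc, ?_⟩
    rw [Set.mem_preimage, hcx]
    exact ⟨hx, mem_extChartAt_source (f x)⟩
  have hder : fderiv ℝ fh (c x) = mfderiv I J f x := by
    have h0 : mfderiv I J f x = fderivWithin ℝ (writtenInExtChartAt I J x f) Set.univ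
        (extChartAt I x x) := by
      rw [← I.range_eq_univ]
      exact hmd.mfderiv
    rw [fderivWithin_univ] at h0
    exact h0.symm
  let e : E ≃L[ℝ] E' := ContinuousLinearEquiv.ofBijective (fderiv ℝ fh (c x))
    (LinearMap.ker_eq_bot.2 (by rw [hder]; exact hb.1))
    (LinearMap.range_eq_top.2 (by rw [hder]; exact hb.2))
  obtain ⟨Φ, h1, h2, h3, h4⟩ := hfh.exists_openPartialHomeomorph hV hcV e
    (ContinuousLinearEquiv.coe_ofBijective _ _ _)
  let Φ' : PartialDiffeomorph 𝓘(ℝ, E) 𝓘(ℝ, E') E E' ∞ :=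
    { toPartialEquiv := Φ.toPartialEquiv
      open_source := Φ.open_source
      open_target := Φ.open_target
      contMDiffOn_toFun := contMDiffOn_iff_contDiffOn.2
        ((hfh.mono h2).congr fun u hu => (h3 hu).symm)
      contMDiffOn_invFun := contMDiffOn_iff_contDiffOn.2 h4 }
  -- The source of `Φ` lies where the chart expression of `f` is defined, so `Φ` composed with the
  -- two charts recovers `f` itself.
  have key : ∀ z ∈ c.source, c z ∈ Φ.source → Φ (c z) = d (f z) ∧ f z ∈ d.source := by
    intro z hz hz'
    have h5 := h3 hz'
    have h6 : c.symm (c z) = z := c.left_inv hz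
    have h7 := (h2 hz').2.2
    rw [Set.mem_preimage, h6] at h7
    refine ⟨?_, h7⟩
    rw [← h5]
    change d (f (c.symm (c z))) = _
    rw [h6]
  refine ⟨(c.trans Φ').trans d.symm, ⟨⟨hxc, h1⟩, ?_⟩, ?_⟩
  · change Φ (c x) ∈ d.target
    rw [(key x hxc h1).1]
    exact d.map_source (key x hxc h1).2
  · rintro z ⟨⟨hz, hz'⟩, -⟩
    change _ = d.symm (Φ (c z))
    rw [(key z hz hz').1]
    exact (d.left_inv (key z hz hz').2).symm

/-- An injective local diffeomorphism on an open set is a diffeomorphism onto its image. -/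
theorem exists_partialDiffeomorph_of_injOn {n : WithTop ℕ∞} {f : X → Y} {S : Set X} (hS : IsOpen S)
    (hf : ∀ x ∈ S, IsLocalDiffeomorphAt I J n f x) (hi : Set.InjOn f S) (hne : Nonempty X) :
    ∃ Φ : PartialDiffeomorph I J X Y n, Φ.source = S ∧ Φ.target = f '' S ∧ Set.EqOn f Φ S := by
  have hopen : ∀ W ⊆ S, IsOpen W → IsOpen (f '' W) := by
    intro W hWS hW
    rw [isOpen_iff_mem_nhds]
    rintro _ ⟨x, hx, rfl⟩
    obtain ⟨Φ, h1, h2⟩ := hf x (hWS hx)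
    refine Filter.mem_of_superset ((Φ.toOpenPartialHomeomorph.isOpen_image_of_subset_source
      (hW.inter Φ.open_source) Set.inter_subset_right).mem_nhds ⟨x, ⟨hx, h1⟩, (h2 h1).symm⟩) ?_
    rintro _ ⟨z, hz, rfl⟩
    exact ⟨z, hz.1, h2 hz.2⟩
  refine ⟨{ toPartialEquiv := (Set.BijOn.toPartialEquiv f S (f '' S) hi.bijOn_image)
            open_source := hS
            open_target := hopen S subset_rfl hS
            contMDiffOn_toFun := fun x hx => (hf x hx).contMDiffAt.contMDiffWithinAt
            contMDiffOn_invFun := ?_ }, rfl, rfl, fun _ _ => rfl⟩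
  rintro _ ⟨x, hx, rfl⟩
  refine ContMDiffAt.contMDiffWithinAt ?_
  obtain ⟨Φ, h1, h2⟩ := hf x hx
  have hsm : ContMDiffAt J I n Φ.symm (f x) :=
    Φ.symm.contMDiffOn.contMDiffAt (Φ.open_target.mem_nhds (by rw [h2 h1]; exact Φ.map_source h1))
  refine hsm.congr_of_eventuallyEq ?_
  -- Near `f x` the global inverse must agree with the smooth local one: the image of `S ∩ Φ.source`
  -- is an open set on which injectivity identifies them.
  filter_upwards [(hopen (S ∩ Φ.source) Set.inter_subset_left (hS.inter Φ.open_source)).mem_nhds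
    ⟨x, ⟨hx, h1⟩, rfl⟩]
  rintro _ ⟨z, hz, rfl⟩
  have e1 : Φ.symm (f z) = z := by rw [h2 hz.2]; exact Φ.left_inv hz.2
  rw [e1]
  exact (Set.BijOn.toPartialEquiv f S (f '' S) hi.bijOn_image).left_inv hz.1

end LocalDiffeo

/-! ### Smooth structures pushed forward along local homeomorphisms -/

section Pushforward

variable {E : Type*} [NormedAddCommGroup E] [NormedSpace ℝ E]
  {X : Type*} [TopologicalSpace X] [ChartedSpace E X]
  {Y : Type*} [TopologicalSpace Y] {f : X → Y}

/-- The charted space structure on the target of a surjective local homeomorphism, with charts the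
local inverses followed by charts of the source. -/
@[reducible]
noncomputable def IsLocalHomeomorph.pushforwardChartedSpace (hf : IsLocalHomeomorph f)
    (hs : Function.Surjective f) : ChartedSpace E Y where
  atlas := Set.range fun a => (hf a).choose.symm.trans (chartAt E a)
  chartAt y := (hf (Function.surjInv hs y)).choose.symm.trans (chartAt E (Function.surjInv hs y))
  mem_chart_source y := by
    have h := (hf (Function.surjInv hs y)).choose_spec
    have h1 : (hf (Function.surjInv hs y)).choose (Function.surjInv hs y) = y := by
      exact (congrFun h.2 _).symm.trans (Function.surjInv_eq hs y)
    have h2 := (hf (Function.surjInv hs y)).choose.map_source h.1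
    have h3 := (hf (Function.surjInv hs y)).choose.left_inv h.1
    rw [h1] at h2 h3
    refine ⟨h2, ?_⟩
    change (hf (Function.surjInv hs y)).choose.symm y ∈ (chartAt E (Function.surjInv hs y)).source
    rw [h3]
    exact mem_chart_source _ _
  chart_mem_atlas y := ⟨_, rfl⟩

/-- If points with the same image under a local homeomorphism `f` are related by germs of smooth
maps commuting with `f`, then the target of `f` is a smooth manifold and `f` is a local
diffeomorphism. -/
theorem IsLocalHomeomorph.pushforward_isManifold [IsManifold 𝓘(ℝ, E) ∞ X]
    (hf : IsLocalHomeomorph f)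
    (hs : Function.Surjective f)
    (hτ : ∀ a b, f a = f b → ∃ τ : X → X, ContMDiffAt 𝓘(ℝ, E) 𝓘(ℝ, E) ∞ τ a ∧ τ a = b ∧
      ∀ᶠ z in 𝓝 a, f (τ z) = f z) :
    let _ := hf.pushforwardChartedSpace (E := E) hs
    IsManifold 𝓘(ℝ, E) ∞ Y ∧ IsLocalDiffeomorph 𝓘(ℝ, E) 𝓘(ℝ, E) ∞ f := by
  let _ := hf.pushforwardChartedSpace (E := E) hs
  have hΦ : ∀ a, f = (hf a).choose := fun a => (hf a).choose_spec.2
  -- Over a common point `y`, two local inverses of `f` differ by a smooth germ `τ`; this is what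
  -- makes the chart changes smooth.
  have key : ∀ a b : X, ∀ y ∈ (hf a).choose.target, y ∈ (hf b).choose.target →
      ∃ τ : X → X, ContMDiffAt 𝓘(ℝ, E) 𝓘(ℝ, E) ∞ τ ((hf a).choose.symm y) ∧
        τ ((hf a).choose.symm y) = (hf b).choose.symm y ∧
        ∀ᶠ z in 𝓝 ((hf a).choose.symm y), (hf b).choose.symm (f z) = τ z := by
    intro a b y hya hyb
    have h1 : f ((hf a).choose.symm y) = y := by
      rw [congrFun (hΦ a), (hf a).choose.right_inv hya]
    have h2 : f ((hf b).choose.symm y) = y := by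
      rw [congrFun (hΦ b), (hf b).choose.right_inv hyb]
    obtain ⟨τ, t1, t2, t3⟩ := hτ _ _ (h1.trans h2.symm)
    refine ⟨τ, t1, t2, ?_⟩
    have h4 : τ ⁻¹' (hf b).choose.source ∈ 𝓝 ((hf a).choose.symm y) :=
      t1.continuousAt ((hf b).choose.open_source.mem_nhds
        (by rw [t2]; exact (hf b).choose.map_target hyb))
    filter_upwards [t3, h4] with z hz hz'
    rw [← hz, congrFun (hΦ b), (hf b).choose.left_inv hz']
  have hman : IsManifold 𝓘(ℝ, E) ∞ Y := by
    apply isManifold_of_contDiffOn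
    rintro _ _ ⟨a, rfl⟩ ⟨b, rfl⟩
    intro u hu
    simp only [mfld_simps] at hu
    obtain ⟨⟨hu1, hu2⟩, hu3, hu4⟩ := hu
    set z₀ := (chartAt E a).symm u with hz₀
    have e1 : (hf a).choose.symm ((hf a).choose z₀) = z₀ := (hf a).choose.left_inv hu2
    obtain ⟨τ, t1, t2, t3⟩ := key a b _ ((hf a).choose.map_source hu2) hu3
    rw [e1] at t1 t2 t3
    have hcu : ContMDiffAt 𝓘(ℝ, E) 𝓘(ℝ, E) ∞ (chartAt E a).symm u :=
      (contMDiffOn_chart_symm (I := 𝓘(ℝ, E))).contMDiffAt ((chartAt E a).open_target.mem_nhds hu1)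
    have hcv : ContMDiffAt 𝓘(ℝ, E) 𝓘(ℝ, E) ∞ (chartAt E b) (τ z₀) :=
      (contMDiffOn_chart (I := 𝓘(ℝ, E))).contMDiffAt
        ((chartAt E b).open_source.mem_nhds (by rw [t2]; exact hu4))
    have hcomp : ContMDiffAt 𝓘(ℝ, E) 𝓘(ℝ, E) ∞
        (fun v => chartAt E b (τ ((chartAt E a).symm v))) u :=
      ContMDiffAt.comp u (g := chartAt E b) hcv (ContMDiffAt.comp u (g := τ) t1 hcu)
    refine ContDiffAt.contDiffWithinAt ?_
    refine (contMDiffAt_iff_contDiffAt.1 hcomp).congr_of_eventuallyEq ?_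
    filter_upwards [hcu.continuousAt.eventually t3] with v hv
    simp only [mfld_simps]
    rw [← hv, congrFun (hΦ a)]
  refine ⟨hman, ?_⟩
  -- In the chart `e` built at `b`, the map `f` reads as `chartAt E b` near `b`, and the chosen
  -- local inverse reads as the inverse of that chart.
  have hloc : ∀ b, ContMDiffAt 𝓘(ℝ, E) 𝓘(ℝ, E) ∞ f b ∧
      ContMDiffAt 𝓘(ℝ, E) 𝓘(ℝ, E) ∞ (hf b).choose.symm (f b) := by
    intro b
    set e := (hf b).choose.symm.trans (chartAt E b) with he
    have hmem : e ∈ IsManifold.maximalAtlas 𝓘(ℝ, E) ∞ Y :=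
      IsManifold.subset_maximalAtlas ⟨b, rfl⟩
    have hb := (hf b).choose_spec.1
    have hfb : (hf b).choose b = f b := (congrFun (hΦ b) b).symm
    have hl : (hf b).choose.symm (f b) = b := by rw [← hfb]; exact (hf b).choose.left_inv hb
    have hsrc : f b ∈ e.source := by
      refine ⟨?_, ?_⟩
      · rw [← hfb]; exact (hf b).choose.map_source hb
      · change (hf b).choose.symm (f b) ∈ (chartAt E b).source
        rw [hl]
        exact mem_chart_source _ _
    have hev : e (f b) = chartAt E b b := by
      change chartAt E b ((hf b).choose.symm (f b)) = _
      rw [hl]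
    have s1 : ContMDiffAt 𝓘(ℝ, E) 𝓘(ℝ, E) ∞ e (f b) := contMDiffAt_of_mem_maximalAtlas hmem hsrc
    have s2 : ContMDiffAt 𝓘(ℝ, E) 𝓘(ℝ, E) ∞ e.symm (chartAt E b b) :=
      contMDiffAt_symm_of_mem_maximalAtlas hmem (by rw [← hev]; exact e.map_source hsrc)
    have s3 : ContMDiffAt 𝓘(ℝ, E) 𝓘(ℝ, E) ∞ (chartAt E b) b :=
      (contMDiffOn_chart (I := 𝓘(ℝ, E))).contMDiffAt
        ((chartAt E b).open_source.mem_nhds (mem_chart_source _ _))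
    have s4 : ContMDiffAt 𝓘(ℝ, E) 𝓘(ℝ, E) ∞ (chartAt E b).symm (e (f b)) := by
      rw [hev]
      exact (contMDiffOn_chart_symm (I := 𝓘(ℝ, E))).contMDiffAt
        ((chartAt E b).open_target.mem_nhds (mem_chart_target _ _))
    constructor
    · refine (ContMDiffAt.comp b (g := e.symm) s2 s3).congr_of_eventuallyEq ?_
      filter_upwards [(chartAt E b).open_source.mem_nhds (mem_chart_source _ _)] with z hz
      change f z = (hf b).choose ((chartAt E b).symm (chartAt E b z))
      rw [(chartAt E b).left_inv hz, ← congrFun (hΦ b)]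
    · refine (ContMDiffAt.comp (f b) (g := (chartAt E b).symm) s4 s1).congr_of_eventuallyEq ?_
      filter_upwards [e.open_source.mem_nhds hsrc] with w hw
      exact ((chartAt E b).left_inv hw.2).symm
  intro a
  refine ⟨{ toPartialEquiv := (hf a).choose.toPartialEquiv
            open_source := (hf a).choose.open_source
            open_target := (hf a).choose.open_target
            contMDiffOn_toFun := ?_
            contMDiffOn_invFun := ?_ }, (hf a).choose_spec.1, fun z _ => congrFun (hΦ a) z⟩
  · intro z hz
    have := (hloc z).1.contMDiffWithinAt (s := (hf a).choose.source)
    exact this.congr (fun w _ => (congrFun (hΦ a) w).symm) (congrFun (hΦ a) z).symm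
  · intro y hy
    refine ContMDiffAt.contMDiffWithinAt ?_
    set z := (hf a).choose.symm y with hz
    have hfz : f z = y := by rw [congrFun (hΦ a), hz, (hf a).choose.right_inv hy]
    have h2 := (hloc z).2
    rw [hfz] at h2
    refine h2.congr_of_eventuallyEq ?_
    have hc : ContinuousAt (hf a).choose.symm y := (hf a).choose.continuousAt_symm hy
    -- `hloc` controls a local inverse only at its own centre, so the inverse chosen at `a` is
    -- compared near `y` with the one chosen at `z`.
    filter_upwards [(hf a).choose.open_target.mem_nhds hy,
      hc.eventually ((hf z).choose.open_source.mem_nhds (hf z).choose_spec.1)] with w hw hw'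
    have h3 : (hf z).choose ((hf a).choose.symm w) = w := by
      rw [← congrFun (hΦ z), congrFun (hΦ a), (hf a).choose.right_inv hw]
    have h4 := (hf z).choose.left_inv hw'
    rw [h3] at h4
    exact h4.symm

end Pushforward

/-! ### Differentials of transverse coordinates and of leaf inclusions -/

namespace Foliation

variable {p q : ℕ} {M : Type*} [TopologicalSpace M] [ChartedSpace (RSpace (p + q)) M]
  (F : Foliation p q M)

section Leaves

/-- The differential at `z` of the transverse coordinate of the chosen chart around `y`. -/
noncomputable def transverseDeriv (y z : M) : RSpace (p + q) →L[ℝ] RSpace q :=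
  mfderiv 𝓘(ℝ, RSpace (p + q)) 𝓘(ℝ, RSpace q) (fun w => (F.someChart y w).2) z

theorem contMDiffOn_transverse {φ : OpenPartialHomeomorph M (RSpace p × RSpace q)}
    (hφ : φ ∈ F.charts) :
    ContMDiffOn 𝓘(ℝ, RSpace (p + q)) 𝓘(ℝ, RSpace q) ∞ (fun w => (φ w).2) φ.source :=
  (contDiff_snd (𝕜 := ℝ) (E := RSpace p) (F := RSpace q)).contMDiff.comp_contMDiffOn
    (F.contMDiffOn_chart φ hφ)

theorem contMDiffOn_leafCoord {φ : OpenPartialHomeomorph M (RSpace p × RSpace q)}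
    (hφ : φ ∈ F.charts) :
    ContMDiffOn 𝓘(ℝ, RSpace (p + q)) 𝓘(ℝ, RSpace p) ∞ (fun w => (φ w).1) φ.source :=
  (contDiff_fst (𝕜 := ℝ) (E := RSpace p) (F := RSpace q)).contMDiff.comp_contMDiffOn
    (F.contMDiffOn_chart φ hφ)

theorem hasMFDerivAt_transverse (y : M) :
    HasMFDerivAt 𝓘(ℝ, RSpace (p + q)) 𝓘(ℝ, RSpace q) (fun w => (F.someChart y w).2) y
      (F.transverseDeriv y y) :=
  (((F.contMDiffOn_transverse (F.someChart_mem y)).contMDiffAt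
    ((F.someChart y).open_source.mem_nhds (F.mem_someChart_source y))).mdifferentiableAt
      (by simp)).hasMFDerivAt

/-- The slice `s` with constant leaf coordinate is a local section of the transverse coordinate, so
the chain rule gives a right inverse. -/
theorem surjective_transverseDeriv (y : M) : Function.Surjective (F.transverseDeriv y y) := by
  set φ := F.someChart y with hφ
  let s : RSpace q → M := fun b => φ.symm ((φ y).1, b)
  have hy : y ∈ φ.source := F.mem_someChart_source y
  have hs0 : s (φ y).2 = y := φ.left_inv hy
  have hmem : φ.target ∈ 𝓝 (((φ y).1, (φ y).2) : RSpace p × RSpace q) :=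
    φ.open_target.mem_nhds (φ.map_source hy)
  have hs : ContMDiffAt 𝓘(ℝ, RSpace q) 𝓘(ℝ, RSpace (p + q)) ∞ s (φ y).2 := by
    refine ContMDiffAt.comp (φ y).2 (g := φ.symm) (f := fun b => ((φ y).1, b))
      (I' := 𝓘(ℝ, RSpace p × RSpace q)) ?_ ?_
    · exact (F.contMDiffOn_chart_symm φ (F.someChart_mem y)).contMDiffAt hmem
    · exact (contDiff_const.prodMk contDiff_id).contMDiff.contMDiffAt
  have hP := F.hasMFDerivAt_transverse y
  have h1 : HasMFDerivAt 𝓘(ℝ, RSpace (p + q)) 𝓘(ℝ, RSpace q) (fun w => (φ w).2) (s (φ y).2)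
      (F.transverseDeriv y y) := by
    have : ∀ z, z = y → HasMFDerivAt 𝓘(ℝ, RSpace (p + q)) 𝓘(ℝ, RSpace q) (fun w => (φ w).2) z
      (F.transverseDeriv y y) := by rintro _ rfl; exact hP
    exact this _ hs0
  have h2 := h1.comp _ (hs.mdifferentiableAt (by simp)).hasMFDerivAt
  have h3 : HasMFDerivAt 𝓘(ℝ, RSpace q) 𝓘(ℝ, RSpace q) ((fun w => (φ w).2) ∘ s) (φ y).2
      (ContinuousLinearMap.id ℝ (RSpace q)) := by
    refine (hasMFDerivAt_id (I := 𝓘(ℝ, RSpace q)) _).congr_of_eventuallyEq ?_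
    have hc : Continuous fun b : RSpace q => ((φ y).1, b) := by fun_prop
    filter_upwards [hc.continuousAt.eventually hmem] with b hb
    change (φ (φ.symm ((φ y).1, b))).2 = b
    rw [φ.right_inv hb]
  have h4 := hasMFDerivAt_unique h2 h3
  intro v
  exact ⟨_, DFunLike.congr_fun h4 v⟩

variable {F} {x : M}

namespace Leaf

variable [IsManifold 𝓘(ℝ, RSpace (p + q)) ∞ M]

/-- The inclusion of a leaf is smooth. -/
theorem contMDiff_val : ContMDiff 𝓘(ℝ, RSpace p) 𝓘(ℝ, RSpace (p + q)) ∞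
    (val : F.Leaf x → M) := by
  intro l
  set φ := F.someChart l.val with hφ
  have hl : l.val ∈ φ.source := F.mem_someChart_source l.val
  have h1 : ContMDiffAt 𝓘(ℝ, RSpace p) 𝓘(ℝ, RSpace p) ∞ (chartAt (RSpace p) l) l :=
    (_root_.contMDiffOn_chart (I := 𝓘(ℝ, RSpace p))).contMDiffAt
      ((chartAt (RSpace p) l).open_source.mem_nhds (mem_chart_source _ _))
  have h2 : ContMDiffAt 𝓘(ℝ, RSpace p) 𝓘(ℝ, RSpace (p + q)) ∞
      (fun a : RSpace p => φ.symm (a, (φ l.val).2)) (chartAt (RSpace p) l l) := by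
    refine ContMDiffAt.comp _ (g := φ.symm) (f := fun a => (a, (φ l.val).2))
      (I' := 𝓘(ℝ, RSpace p × RSpace q)) ?_ ?_
    · exact (F.contMDiffOn_chart_symm φ (F.someChart_mem _)).contMDiffAt
        (φ.open_target.mem_nhds (φ.map_source hl))
    · exact (contDiff_id.prodMk contDiff_const).contMDiff.contMDiffAt
  refine (ContMDiffAt.comp l (g := fun a : RSpace p => φ.symm (a, (φ l.val).2)) h2 h1
    ).congr_of_eventuallyEq ?_
  filter_upwards [(chartAt (RSpace p) l).open_source.mem_nhds (mem_chart_source _ _)] with l' hl'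
  change l'.val = φ.symm ((φ l'.val).1, (φ l.val).2)
  rw [← show (φ l'.val).2 = (φ l.val).2 from hl'.2]
  exact (φ.left_inv hl'.1).symm

theorem hasMFDerivAt_val (l : F.Leaf x) : HasMFDerivAt 𝓘(ℝ, RSpace p) 𝓘(ℝ, RSpace (p + q))
    (val : F.Leaf x → M) l (mfderiv 𝓘(ℝ, RSpace p) 𝓘(ℝ, RSpace (p + q)) val l) :=
  ((contMDiff_val l).mdifferentiableAt (by simp)).hasMFDerivAt

/-- The differential of the inclusion of a leaf, with values in the model space. -/
noncomputable def valDeriv (l : F.Leaf x) : RSpace p →L[ℝ] RSpace (p + q) :=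
  mfderiv 𝓘(ℝ, RSpace p) 𝓘(ℝ, RSpace (p + q)) val l

/-- The transverse coordinate is constant on the plaque through `l`, which is a neighbourhood of `l`
in the leaf topology. -/
theorem transverseDeriv_valDeriv (l : F.Leaf x) (w : RSpace p) :
    F.transverseDeriv l.val l.val (valDeriv l w) = 0 := by
  have h1 := (F.hasMFDerivAt_transverse l.val).comp l (hasMFDerivAt_val l)
  have h2 : HasMFDerivAt 𝓘(ℝ, RSpace p) 𝓘(ℝ, RSpace q)
      ((fun w => (F.someChart l.val w).2) ∘ val) l (0 : RSpace p →L[ℝ] RSpace q) := by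
    refine (hasMFDerivAt_const (F.someChart l.val l.val).2 l).congr_of_eventuallyEq ?_
    filter_upwards [(chartAt (RSpace p) l).open_source.mem_nhds (mem_chart_source _ _)] with l' hl'
    exact hl'.2
  exact DFunLike.congr_fun (hasMFDerivAt_unique h1 h2) w

/-- The chart of the leaf is the leaf coordinate of M composed with the inclusion, and the
differential of a chart is injective. -/
theorem injective_valDeriv (l : F.Leaf x) : Function.Injective (valDeriv l) := by
  have hc : MDifferentiableAt 𝓘(ℝ, RSpace (p + q)) 𝓘(ℝ, RSpace p)
      (fun w => (F.someChart l.val w).1) l.val :=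
    ((F.contMDiffOn_leafCoord (F.someChart_mem l.val)).contMDiffAt
    ((F.someChart l.val).open_source.mem_nhds (F.mem_someChart_source l.val))).mdifferentiableAt
      (by simp)
  have h1 := hc.hasMFDerivAt.comp l (hasMFDerivAt_val l)
  have hch : (chartAt (RSpace p) l).MDifferentiable 𝓘(ℝ, RSpace p) 𝓘(ℝ, RSpace p) :=
    mdifferentiable_chart l
  have h2 := hch.mfderiv_injective (mem_chart_source _ l)
  have h3 : mfderiv 𝓘(ℝ, RSpace p) 𝓘(ℝ, RSpace p) (chartAt (RSpace p) l) l = _ := h1.mfderiv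
  rw [h3] at h2
  exact Function.Injective.of_comp h2

end Leaf

end Leaves

/-! ### The action map from G × L to M -/

section Action

variable {F} {G : Type*} [Group G] [TopologicalSpace G] [ChartedSpace (RSpace q) G]
  [MulAction G M]

/-- The differential at `1` of the orbit map, with values in the model space. -/
noncomputable def orbitDeriv (p q : ℕ) {M : Type*} [TopologicalSpace M]
    [ChartedSpace (RSpace (p + q)) M] (G : Type*) [Group G] [TopologicalSpace G]
    [ChartedSpace (RSpace q) G] [MulAction G M] (y : M) : RSpace q →L[ℝ] RSpace (p + q) :=
  mfderiv 𝓘(ℝ, RSpace q) 𝓘(ℝ, RSpace (p + q)) (fun g : G => g • y) 1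

/-- The leaf tangent space is the kernel of the transverse differential, so by transversality the
orbit directions alone already surject onto ℝ^q. A surjective endomorphism of ℝ^q is bijective. -/
theorem IsInvariantTransverse.bijective_transverseDeriv_comp (hF : F.IsInvariantTransverse G)
    (y : M) : Function.Bijective ((F.transverseDeriv y y).comp (orbitDeriv p q G y)) := by
  have h : (F.transverseDeriv ((1 : G) • y) ((1 : G) • y)).ker ⊔ (orbitDeriv p q G y).range =
    (⊤ : Submodule ℝ (RSpace (p + q))) := hF.transverse y
  rw [one_smul] at h
  have hs : Function.Surjective ((F.transverseDeriv y y).comp (orbitDeriv p q G y)) := by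
    intro b
    obtain ⟨v, rfl⟩ := F.surjective_transverseDeriv y b
    have hv : v ∈ (F.transverseDeriv y y).ker ⊔ (orbitDeriv p q G y).range := by
      rw [h]; trivial
    obtain ⟨k, hk, _, ⟨u, rfl⟩, rfl⟩ := Submodule.mem_sup.1 hv
    refine ⟨u, ?_⟩
    have hk' : F.transverseDeriv y y k = 0 := hk
    rw [map_add, hk', zero_add]
    rfl
  exact ⟨(LinearMap.injective_iff_surjective
    (f := ((F.transverseDeriv y y).comp (orbitDeriv p q G y) : RSpace q →ₗ[ℝ] RSpace q))).2 hs, hs⟩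

variable [ContMDiffSMul 𝓘(ℝ, RSpace q) 𝓘(ℝ, RSpace (p + q)) ∞ G M]

theorem contMDiff_orbit (y : M) : ContMDiff 𝓘(ℝ, RSpace q) 𝓘(ℝ, RSpace (p + q)) ∞
    (fun g : G => g • y) :=
  (contMDiff_smul (I := 𝓘(ℝ, RSpace q)) (I' := 𝓘(ℝ, RSpace (p + q)))).comp
    (contMDiff_id.prodMk contMDiff_const)

theorem hasMFDerivAt_orbit (y : M) :
    HasMFDerivAt 𝓘(ℝ, RSpace q) 𝓘(ℝ, RSpace (p + q)) (fun g : G => g • y) 1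
      (orbitDeriv p q G y) :=
  ((contMDiff_orbit y (1 : G)).mdifferentiableAt (by simp)).hasMFDerivAt

/-- The transverse coordinate of `g • y`, as a function of `g`, is a local diffeomorphism at
`1`. -/
theorem IsInvariantTransverse.isLocalDiffeomorphAt_transverse [IsManifold 𝓘(ℝ, RSpace q) ∞ G]
    (hF : F.IsInvariantTransverse G) (y : M) :
    IsLocalDiffeomorphAt 𝓘(ℝ, RSpace q) 𝓘(ℝ, RSpace q) ∞
      (fun g : G => (F.someChart y (g • y)).2) 1 := by
  have h1 : HasMFDerivAt 𝓘(ℝ, RSpace (p + q)) 𝓘(ℝ, RSpace q) (fun w => (F.someChart y w).2)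
      ((1 : G) • y) (F.transverseDeriv y y) := by
    have : ∀ z, z = y → HasMFDerivAt 𝓘(ℝ, RSpace (p + q)) 𝓘(ℝ, RSpace q)
      (fun w => (F.someChart y w).2) z
      (F.transverseDeriv y y) := by rintro _ rfl; exact F.hasMFDerivAt_transverse _
    exact this _ (one_smul _ _)
  have h2 := h1.comp (1 : G) (hasMFDerivAt_orbit (p := p) (q := q) y)
  refine isLocalDiffeomorphAt_of_bijective_mfderiv
    (U := (fun g : G => g • y) ⁻¹' (F.someChart y).source) ?_ ?_ ?_ ?_
  · exact (F.someChart y).open_source.preimage (contMDiff_orbit (p := p) (q := q) y).continuous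
  · exact (F.contMDiffOn_transverse (F.someChart_mem y)).comp
      (contMDiff_orbit y).contMDiffOn fun _ h => h
  · rw [Set.mem_preimage, one_smul]
    exact F.mem_someChart_source y
  · have h3 : mfderiv 𝓘(ℝ, RSpace q) 𝓘(ℝ, RSpace q) (fun g : G => (F.someChart y (g • y)).2) 1 =
      (F.transverseDeriv y y).comp (orbitDeriv p q G y) := h2.mfderiv
    rw [h3]
    exact hF.bijective_transverseDeriv_comp y

variable (G) in
/-- The action map `G × L → M` for a leaf `L`. -/
def leafAction (x : M) (a : G × F.Leaf x) : M := a.1 • a.2.val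

theorem contMDiff_const_smul_of_smooth (g : G) : ContMDiff 𝓘(ℝ, RSpace (p + q))
    𝓘(ℝ, RSpace (p + q)) ∞ (fun y : M => g • y) :=
  (contMDiff_smul (I := 𝓘(ℝ, RSpace q)) (I' := 𝓘(ℝ, RSpace (p + q)))).comp
    (contMDiff_const.prodMk contMDiff_id)

/-- The diffeomorphism of `M` given by the action of a group element. -/
def smulDiffeomorph (g : G) :
    M ≃ₘ^∞⟮𝓘(ℝ, RSpace (p + q)), 𝓘(ℝ, RSpace (p + q))⟯ M where
  toEquiv := MulAction.toPerm g
  contMDiff_toFun := contMDiff_const_smul_of_smooth g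
  contMDiff_invFun := contMDiff_const_smul_of_smooth g⁻¹

variable [IsManifold 𝓘(ℝ, RSpace (p + q)) ∞ M] {x : M}

theorem contMDiff_leafAction : ContMDiff (𝓘(ℝ, RSpace q).prod 𝓘(ℝ, RSpace p))
    𝓘(ℝ, RSpace (p + q)) ∞ (leafAction (F := F) G x) :=
  (contMDiff_smul (I := 𝓘(ℝ, RSpace q)) (I' := 𝓘(ℝ, RSpace (p + q)))).comp
    (contMDiff_fst.prodMk (Leaf.contMDiff_val.comp contMDiff_snd))

/-- The transverse differential kills the leaf part and is injective on the orbit part. A kernel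
vector thus has no orbit component, and then no leaf component because the leaf is immersed;
equality of dimensions gives surjectivity. -/
theorem IsInvariantTransverse.bijective_mfderiv_leafAction (hF : F.IsInvariantTransverse G)
    (l : F.Leaf x) :
    Function.Bijective (mfderiv (𝓘(ℝ, RSpace q).prod 𝓘(ℝ, RSpace p)) 𝓘(ℝ, RSpace (p + q))
      (leafAction (F := F) G x) (1, l)) := by
  have hd : MDifferentiableAt (𝓘(ℝ, RSpace q).prod 𝓘(ℝ, RSpace p)) 𝓘(ℝ, RSpace (p + q))
      (leafAction (F := F) G x) (1, l) := (contMDiff_leafAction _).mdifferentiableAt (by simp)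
  let D : RSpace q × RSpace p →L[ℝ] RSpace (p + q) :=
    mfderiv (𝓘(ℝ, RSpace q).prod 𝓘(ℝ, RSpace p)) 𝓘(ℝ, RSpace (p + q))
      (leafAction (F := F) G x) (1, l)
  have hone : (fun l' : F.Leaf x => leafAction (F := F) G x (1, l')) = Leaf.val := by
    funext l'
    exact one_smul _ _
  have hD : ∀ v w, D (v, w) = orbitDeriv p q G l.val v + Leaf.valDeriv l w := by
    intro v w
    have h1 := mfderiv_prod_eq_add_apply hd (v := ((v, w) : RSpace q × RSpace p))
    refine h1.trans ?_
    let A : RSpace p →L[ℝ] RSpace (p + q) := mfderiv 𝓘(ℝ, RSpace p) 𝓘(ℝ, RSpace (p + q))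
      (fun l' : F.Leaf x => leafAction (F := F) G x (1, l')) l
    have hA : A = Leaf.valDeriv l := by
      unfold A
      rw [hone]
      rfl
    rw [← hA]
    rfl
  have hinj : Function.Injective D := by
    rw [injective_iff_map_eq_zero]
    rintro ⟨v, w⟩ h
    rw [hD] at h
    have h1 := congrArg (F.transverseDeriv l.val l.val) h
    rw [map_add, Leaf.transverseDeriv_valDeriv, add_zero, map_zero] at h1
    have hv : v = 0 := (injective_iff_map_eq_zero _).1 (hF.bijective_transverseDeriv_comp
      l.val).1 v h1
    rw [hv, map_zero, zero_add] at h
    have hw : w = 0 := (injective_iff_map_eq_zero _).1 (Leaf.injective_valDeriv l) w h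
    rw [hv, hw]
    rfl
  refine ⟨hinj, (LinearMap.injective_iff_surjective_of_finrank_eq_finrank
    (f := (D : RSpace q × RSpace p →ₗ[ℝ] RSpace (p + q))) ?_).1 hinj⟩
  simp [add_comm]

variable [LieGroup 𝓘(ℝ, RSpace q) ∞ G]

/-- The diffeomorphism of `G × Y` given by left translation on the first factor. -/
def mulLeftProdDiffeomorph {e : ℕ} (Y : Type*) [TopologicalSpace Y] [ChartedSpace (RSpace e) Y]
    (g : G) : (G × Y) ≃ₘ^∞⟮𝓘(ℝ, RSpace q).prod 𝓘(ℝ, RSpace e),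
      𝓘(ℝ, RSpace q).prod 𝓘(ℝ, RSpace e)⟯ (G × Y) where
  toEquiv := (Equiv.mulLeft g).prodCongr (Equiv.refl Y)
  contMDiff_toFun := (contMDiff_mul_left.comp contMDiff_fst).prodMk contMDiff_snd
  contMDiff_invFun := (contMDiff_mul_left.comp contMDiff_fst).prodMk contMDiff_snd

/-- The action map `G × L → M` is a local diffeomorphism. -/
theorem IsInvariantTransverse.isLocalDiffeomorph_leafAction (hF : F.IsInvariantTransverse G) :
    IsLocalDiffeomorph (𝓘(ℝ, RSpace q).prod 𝓘(ℝ, RSpace p)) 𝓘(ℝ, RSpace (p + q)) ∞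
      (leafAction (F := F) G x) := by
  have : IsManifold 𝓘(ℝ, RSpace q) ∞ G := inferInstance
  rintro ⟨g, l⟩
  have h1 : IsLocalDiffeomorphAt (𝓘(ℝ, RSpace q).prod 𝓘(ℝ, RSpace p)) 𝓘(ℝ, RSpace (p + q)) ∞
      (leafAction (F := F) G x) (1, l) :=
    isLocalDiffeomorphAt_of_bijective_mfderiv isOpen_univ contMDiff_leafAction.contMDiffOn trivial
      (hF.bijective_mfderiv_leafAction l)
  -- The case of (1, l) is transported by equivariance: the action map equals translation by `g` on
  -- M, after the action map, after left translation by `g⁻¹` on G.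
  have h2 := (mulLeftProdDiffeomorph (q := q) (e := p) (F.Leaf x) g⁻¹).isLocalDiffeomorph (g, l)
  have h3 : mulLeftProdDiffeomorph (q := q) (e := p) (F.Leaf x) g⁻¹ (g, l) = (1, l) :=
    Prod.ext (inv_mul_cancel g) rfl
  rw [← h3] at h1
  have h4 := (h2.comp _ _ h1).comp _ _
    ((smulDiffeomorph (p := p) (q := q) (M := M) g).isLocalDiffeomorph _)
  convert h4 using 1
  funext a
  change a.1 • a.2.val = g • (g⁻¹ * a.1) • a.2.val
  rw [smul_smul, mul_inv_cancel_left]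

end Action

end Foliation

/-! ### Countably many plaques of a leaf in a chart -/

namespace Foliation

variable {p q : ℕ} {M : Type*} [TopologicalSpace M] [ChartedSpace (RSpace (p + q)) M]
  (F : Foliation p q M)

section Countability

variable {F} in
/-- Transverse coordinates are locally constant along plaques. -/
theorem eventually_transverse_eq {φ ψ : OpenPartialHomeomorph M (RSpace p × RSpace q)}
    (hφ : φ ∈ F.charts) (hψ : ψ ∈ F.charts) {a : RSpace p} {c : RSpace q} (ha : (a, c) ∈ φ.target)
    (ha' : φ.symm (a, c) ∈ ψ.source) :
    ∀ᶠ b in 𝓝 a, (b, c) ∈ φ.target ∧ φ.symm (b, c) ∈ ψ.source ∧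
      (ψ (φ.symm (b, c))).2 = (ψ (φ.symm (a, c))).2 := by
  obtain ⟨h, hh⟩ := F.compatible φ hφ ψ hψ _ ⟨φ.map_target ha, ha'⟩
  have hcont : ContinuousAt (fun b : RSpace p => φ.symm (b, c)) a :=
    ContinuousAt.comp (f := fun b : RSpace p => (b, c)) (g := φ.symm)
      (φ.continuousAt_symm ha) (by fun_prop)
  have hopen : IsOpen {b : RSpace p | (b, c) ∈ φ.target} :=
    φ.open_target.preimage (by fun_prop)
  filter_upwards [hopen.mem_nhds ha, hcont.eventually hh,
    hcont.eventually (ψ.open_source.mem_nhds ha')] with b hb hb1 hb2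
  refine ⟨hb, hb2, ?_⟩
  rw [hb1, hh.self_of_nhds, φ.right_inv hb, φ.right_inv ha]

/-- The values of the transverse coordinate of `ψ` on the plaque `k.2` of the chart `k.1`. -/
def transverseValues (k : OpenPartialHomeomorph M (RSpace p × RSpace q) × RSpace q)
    (ψ : OpenPartialHomeomorph M (RSpace p × RSpace q)) : Set (RSpace q) :=
  (fun y => (ψ y).2) '' {y | y ∈ k.1.source ∧ (k.1 y).2 = k.2 ∧ y ∈ ψ.source}

variable {F} in
-- The transverse coordinate of `ψ` is locally constant on the part of the plaque inside `ψ.source`,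
-- and this part is Lindelöf.
theorem countable_transverseValues {φ ψ : OpenPartialHomeomorph M (RSpace p × RSpace q)}
    (hφ : φ ∈ F.charts) (hψ : ψ ∈ F.charts) (c : RSpace q) :
    (transverseValues (φ, c) ψ).Countable := by
  let V : Set (RSpace p) := {a | (a, c) ∈ φ.target ∧ φ.symm (a, c) ∈ ψ.source}
  obtain ⟨t, htV, ht, hcov⟩ := TopologicalSpace.countable_cover_nhdsWithin (s := V)
    (f := fun a => {b | (ψ (φ.symm (b, c))).2 = (ψ (φ.symm (a, c))).2}) fun a ha =>
      mem_nhdsWithin_of_mem_nhds ((eventually_transverse_eq hφ hψ ha.1 ha.2).mono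
        fun b hb => hb.2.2)
  refine (ht.image fun a => (ψ (φ.symm (a, c))).2).mono ?_
  rintro _ ⟨y, ⟨h1, h2, h3⟩, rfl⟩
  simp only at h1 h2
  have hy : φ.symm ((φ y).1, c) = y := by rw [← h2]; exact φ.left_inv h1
  have hyV : (φ y).1 ∈ V := by
    refine ⟨?_, by rw [hy]; exact h3⟩
    rw [← h2]
    exact φ.map_source h1
  obtain ⟨a, ha, hb⟩ := Set.mem_iUnion₂.1 (hcov hyV)
  have hb' : (ψ (φ.symm ((φ y).1, c))).2 = (ψ (φ.symm (a, c))).2 := hb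
  rw [hy] at hb'
  exact ⟨a, ha, hb'.symm⟩

/-- The plaques which can be reached from `x` in `n` steps through charts of the family `C`. -/
def reachablePlaques (C : Set (OpenPartialHomeomorph M (RSpace p × RSpace q))) (x : M) :
    ℕ → Set (OpenPartialHomeomorph M (RSpace p × RSpace q) × RSpace q)
  | 0 => (fun ψ => (ψ, (ψ x).2)) '' C
  | n + 1 => ⋃ k ∈ reachablePlaques C x n, ⋃ ψ ∈ C, (fun v => (ψ, v)) '' transverseValues k ψ

variable {F} in
theorem countable_reachablePlaques {C : Set (OpenPartialHomeomorph M (RSpace p × RSpace q))}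
    (hC : C.Countable) (hCF : C ⊆ F.charts) (x : M) (n : ℕ) :
    (reachablePlaques C x n).Countable ∧ ∀ k ∈ reachablePlaques C x n, k.1 ∈ F.charts := by
  induction n with
  | zero =>
    refine ⟨hC.image _, ?_⟩
    rintro _ ⟨ψ, hψ, rfl⟩
    exact hCF hψ
  | succ n ih =>
    refine ⟨ih.1.biUnion fun k hk => hC.biUnion fun ψ hψ =>
      (countable_transverseValues (ih.2 k hk) (hCF hψ) k.2).image _, ?_⟩
    intro k hk
    simp only [reachablePlaques, Set.mem_iUnion] at hk
    obtain ⟨k', -, ψ, hψ, v, -, rfl⟩ := hk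
    exact hCF hψ

variable {F} in
-- Leaves are defined by chains through arbitrary charts, while only the family `C` may be used
-- here. A single plaque of any chart is connected and locally lies in plaques of `C`, so
-- reachability propagates along it.
theorem exists_reachablePlaque {C : Set (OpenPartialHomeomorph M (RSpace p × RSpace q))}
    (hCF : C ⊆ F.charts) (hcov : ∀ y, ∃ φ ∈ C, y ∈ φ.source) {x y : M} (hy : y ∈ F.leaf x) :
    ∃ n, ∃ k ∈ reachablePlaques C x n, y ∈ k.1.source ∧ (k.1 y).2 = k.2 := by
  let Q : M → Prop := fun y => ∃ n, ∃ k ∈ reachablePlaques C x n, y ∈ k.1.source ∧ (k.1 y).2 = k.2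
  have hstep : ∀ y z, ∀ ψ ∈ C, y ∈ ψ.source → z ∈ ψ.source → (ψ y).2 = (ψ z).2 → Q y → Q z := by
    rintro y z ψ hψ hy hz hyz ⟨n, k, hk, hk1, hk2⟩
    refine ⟨n + 1, (ψ, (ψ y).2), ?_, hz, hyz.symm⟩
    simp only [reachablePlaques, Set.mem_iUnion]
    exact ⟨k, hk, ψ, hψ, _, ⟨y, ⟨hk1, hk2, hy⟩, rfl⟩, rfl⟩
  have hplaque : ∀ y z, F.SamePlaque y z → (Q y ↔ Q z) := by
    rintro y z ⟨φ, hφ, hy, hz, hyz⟩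
    obtain ⟨A, B, -, hA, -, hAB⟩ := F.target_eq_prod φ hφ
    have hyt := φ.map_source hy
    have hzt := φ.map_source hz
    rw [hAB] at hyt hzt
    -- Connectedness of the leaf factor `A` turns local invariance of `Q` into invariance along the
    -- whole plaque.
    have key := hA.induction₂' (fun a b => Q (φ.symm (a, (φ y).2)) ↔ Q (φ.symm (b, (φ y).2)))
      (fun a ha => by
        have hat : (a, (φ y).2) ∈ φ.target := by rw [hAB]; exact ⟨ha, hyt.2⟩
        obtain ⟨ψ, hψ, hψ'⟩ := hcov (φ.symm (a, (φ y).2))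
        refine Filter.Eventually.filter_mono nhdsWithin_le_nhds ?_
        filter_upwards [eventually_transverse_eq hφ (hCF hψ) hat hψ'] with b hb
        have : Q (φ.symm (a, (φ y).2)) ↔ Q (φ.symm (b, (φ y).2)) :=
          ⟨hstep _ _ ψ hψ hψ' hb.2.1 hb.2.2.symm, hstep _ _ ψ hψ hb.2.1 hψ' hb.2.2⟩
        exact ⟨this, this.symm⟩)
      (fun _ _ _ _ _ _ h h' => h.trans h') hyt.1 hzt.1
    have e1 : φ.symm ((φ y).1, (φ y).2) = y := φ.left_inv hy
    have e2 : φ.symm ((φ z).1, (φ y).2) = z := by rw [hyz]; exact φ.left_inv hz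
    rwa [e1, e2] at key
  have hleaf : ∀ y z, Relation.EqvGen F.SamePlaque y z → (Q y ↔ Q z) := by
    intro y z h
    induction h with
    | rel y z h => exact hplaque y z h
    | refl y => exact Iff.rfl
    | symm y z _ ih => exact ih.symm
    | trans y z w _ _ ih ih' => exact ih.trans ih'
  refine (hleaf x y hy).1 ?_
  obtain ⟨φ, hφ, hx⟩ := hcov x
  exact ⟨0, _, ⟨φ, hφ, rfl⟩, hx, rfl⟩

variable {F} in
/-- A leaf meets the domain of a foliated chart in at most countably many plaques. -/
theorem countable_transverse_leaf [SecondCountableTopology M]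
    {φ : OpenPartialHomeomorph M (RSpace p × RSpace q)} (hφ : φ ∈ F.charts) (x : M) :
    ((fun y => (φ y).2) '' (F.leaf x ∩ φ.source)).Countable := by
  obtain ⟨s, hs, hcov⟩ := TopologicalSpace.countable_cover_nhds
    (f := fun y : M => (F.someChart y).source)
    fun y => (F.someChart y).open_source.mem_nhds (F.mem_someChart_source y)
  have hCF : F.someChart '' s ⊆ F.charts := by
    rintro _ ⟨y, -, rfl⟩
    exact F.someChart_mem y
  have hcov' : ∀ y, ∃ ψ ∈ F.someChart '' s, y ∈ ψ.source := by
    intro y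
    obtain ⟨z, hz, hy⟩ := Set.mem_iUnion₂.1 (hcov.symm.subset (Set.mem_univ y))
    exact ⟨_, ⟨z, hz, rfl⟩, hy⟩
  have hK := countable_reachablePlaques (hs.image F.someChart) hCF x
  refine (Set.countable_iUnion fun n => (hK n).1.biUnion fun k hk =>
    countable_transverseValues ((hK n).2 k hk) hφ k.2).mono ?_
  rintro _ ⟨y, ⟨hy, hyφ⟩, rfl⟩
  obtain ⟨n, k, hk, h1, h2⟩ := exists_reachablePlaque hCF hcov' hy
  exact Set.mem_iUnion.2 ⟨n, Set.mem_iUnion₂.2 ⟨k, hk, y, ⟨h1, h2, hyφ⟩, rfl⟩⟩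

end Countability

theorem _root_.LieGroup.isTopologicalGroup_and_t2Space (q : ℕ) (G : Type*) [Group G]
    [TopologicalSpace G]
    [ChartedSpace (RSpace q) G] [LieGroup 𝓘(ℝ, RSpace q) ∞ G] :
    IsTopologicalGroup G ∧ T2Space G := by
  have h1 : IsTopologicalGroup G := topologicalGroup_of_lieGroup 𝓘(ℝ, RSpace q) ∞
  have h2 : T1Space G := ChartedSpace.t1Space (RSpace q) G
  exact ⟨h1, inferInstance⟩

/-! ### The group of a leaf, and translates of a leaf -/

section Action

variable {F} {G : Type*} [Group G] [TopologicalSpace G] [ChartedSpace (RSpace q) G]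
  [MulAction G M] (hF : F.IsInvariantTransverse G) (x : M)

theorem mem_leafGroup_iff (g : G) : g ∈ leafGroup hF x ↔ g • x ∈ F.leaf x :=
  ⟨fun h => h x (mem_leaf_self x),
    fun h => (mem_leafGroup_iff_exists hF x g).2 ⟨x, mem_leaf_self x, h⟩⟩

theorem isClosed_leafGroup [ContinuousSMul G M] (h : IsClosed (F.leaf x)) :
    IsClosed (leafGroup hF x : Set G) := by
  have : (leafGroup hF x : Set G) = (fun g => g • x) ⁻¹' F.leaf x :=
    Set.ext fun g => mem_leafGroup_iff hF x g
  rw [this]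
  exact h.preimage (by fun_prop)

variable [ContMDiffSMul 𝓘(ℝ, RSpace q) 𝓘(ℝ, RSpace (p + q)) ∞ G M]
  [LieGroup 𝓘(ℝ, RSpace q) ∞ G]

/-- The group of a closed leaf is discrete: by the Baire category theorem, a closed subgroup of a
Lie group which is locally countable has an isolated point. -/
theorem discreteTopology_leafGroup [SecondCountableTopology M]
    (h : IsClosed (F.leaf x)) : DiscreteTopology (leafGroup hF x) := by
  have := (LieGroup.isTopologicalGroup_and_t2Space q G).1
  have := (LieGroup.isTopologicalGroup_and_t2Space q G).2
  have : ContinuousSMul G M :=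
    ContMDiffSMul.continuousSMul (I := 𝓘(ℝ, RSpace q)) (I' := 𝓘(ℝ, RSpace (p + q))) ∞
  have : LocallyCompactSpace G := ChartedSpace.locallyCompactSpace (RSpace q) G
  obtain ⟨Φ, h1, hΦ⟩ := hF.isLocalDiffeomorphAt_transverse x
  set φ := F.someChart x
  let W : Set G := Φ.source ∩ (fun g => g • x) ⁻¹' φ.source
  have hW : IsOpen W := Φ.open_source.inter (φ.open_source.preimage (by fun_prop))
  have h1W : (1 : G) ∈ W := ⟨h1, by rw [Set.mem_preimage, one_smul]; exact F.mem_someChart_source x⟩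
  let S : Set G := (leafGroup hF x : Set G) ∩ W
  -- Near 1 the transverse coordinate of `g • x` determines `g`; for `g` in H it takes only the
  -- countably many values coming from the leaf.
  have hinj : Set.InjOn (fun g : G => (φ (g • x)).2) S := by
    intro a ha b hb hab
    have ha' := hΦ ha.2.1
    have hb' := hΦ hb.2.1
    exact Φ.injOn ha.2.1 hb.2.1 (ha'.symm.trans (hab.trans hb'))
  have hSc : S.Countable := by
    refine Set.countable_of_injective_of_countable_image hinj
      ((countable_transverse_leaf (F.someChart_mem x) x).mono ?_)
    rintro _ ⟨g, hg, rfl⟩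
    exact ⟨g • x, ⟨(mem_leafGroup_iff hF x g).1 hg.1, hg.2.2⟩, rfl⟩
  have hloc : IsLocallyClosed S :=
    (isClosed_leafGroup hF x h).isLocallyClosed.inter hW.isLocallyClosed
  have : LocallyCompactSpace S := hloc.locallyCompactSpace
  have : Countable S := hSc.to_subtype
  have : Nonempty S := ⟨⟨1, one_mem _, h1W⟩⟩
  -- `S` is a nonempty Baire space, being locally compact Hausdorff, and a countable union of its
  -- points, so some point is open in it.
  obtain ⟨s, hs⟩ := nonempty_interior_of_iUnion_of_closed (f := fun s : S => {s})
    (fun s => isClosed_singleton) (Set.eq_univ_of_forall fun s => Set.mem_iUnion.2 ⟨s, rfl⟩)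
  have hs' : IsOpen ({s} : Set S) := by
    have : interior ({s} : Set S) = {s} :=
      (Set.Nonempty.subset_singleton_iff hs).1 interior_subset
    rw [← this]
    exact isOpen_interior
  obtain ⟨V, hV, hVs⟩ := isOpen_induced_iff.1 hs'
  apply discreteTopology_of_isOpen_singleton_one
  -- Translation by `s` moves the isolated point to 1; intersecting with `W` keeps `s * g` inside
  -- `S`, where isolation is known.
  refine isOpen_induced_iff.2 ⟨(fun g => s.1 * g) ⁻¹' (V ∩ W),
    (hV.inter hW).preimage (continuous_const_mul _), ?_⟩
  ext ⟨g, hg⟩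
  simp only [Set.mem_preimage, Set.mem_singleton_iff, Subgroup.mk_eq_one]
  constructor
  · rintro ⟨h2, h3⟩
    have h4 : (⟨s.1 * g, mul_mem s.2.1 hg, h3⟩ : S) ∈ ({s} : Set S) := by rw [← hVs]; exact h2
    have h5 : s.1 * g = s.1 := congrArg Subtype.val h4
    simpa using h5
  · rintro rfl
    have h4 : s ∈ (Subtype.val ⁻¹' V : Set S) := by rw [hVs]; rfl
    rw [mul_one]
    exact ⟨h4, s.2.2⟩

variable [ConnectedSpace M] [IsManifold 𝓘(ℝ, RSpace (p + q)) ∞ M]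

omit [ContMDiffSMul 𝓘(ℝ, RSpace q) 𝓘(ℝ, RSpace (p + q)) ∞ G M]
  [LieGroup 𝓘(ℝ, RSpace q) ∞ G] [ConnectedSpace M] [IsManifold 𝓘(ℝ, RSpace (p + q)) ∞ M] in
include hF in
variable {x} in
theorem smul_mem_leaf {y : M} (g : G) (h : y ∈ F.leaf x) : g • y ∈ F.leaf (g • x) := by
  rw [← hF.image_leaf]
  exact ⟨y, h, rfl⟩

include hF in
/-- By connectedness, the translates of a leaf by the group fill the manifold. -/
theorem surjective_leafAction : Function.Surjective (leafAction (F := F) G x) := by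
  have hopen : ∀ y, IsOpen (Set.range (leafAction (F := F) G y)) := fun y =>
    hF.isLocalDiffeomorph_leafAction.isOpen_range
  have hself : ∀ y, y ∈ Set.range (leafAction (F := F) G y) := fun y =>
    ⟨(1, Leaf.mk y (mem_leaf_self y)), one_smul _ _⟩
  -- If the open set swept out by the leaf of `y` meets the one swept out by the leaf of `x`, then a
  -- translate of the leaf of `x` is the leaf of `y`, so `y` is in the range after all.
  have hcl : IsClosed (Set.range (leafAction (F := F) G x)) := by
    rw [← isOpen_compl_iff, isOpen_iff_mem_nhds]
    intro y hy
    refine Filter.mem_of_superset ((hopen y).mem_nhds (hself y)) ?_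
    rintro _ ⟨⟨g, l⟩, rfl⟩ ⟨⟨g', l'⟩, h⟩
    apply hy
    have h1 : g' • l'.val = g • l.val := h
    have h2 : l.val = (g⁻¹ * g') • l'.val := by rw [mul_smul, h1, inv_smul_smul]
    have h3 : l.val ∈ F.leaf ((g⁻¹ * g') • x) := by
      rw [h2]
      exact smul_mem_leaf hF _ l'.val_mem
    have h4 : y ∈ F.leaf ((g⁻¹ * g') • x) := by
      rw [← leaf_eq_of_mem h3, leaf_eq_of_mem l.val_mem]
      exact mem_leaf_self y
    rw [← hF.image_leaf] at h4
    obtain ⟨z, hz, hzy⟩ := h4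
    exact ⟨(g⁻¹ * g', Leaf.mk z hz), hzy⟩
  exact Set.range_eq_univ.1 (IsClopen.eq_univ ⟨hcl, hopen x⟩ ⟨x, hself x⟩)

include hF in
theorem exists_smul_mem_leaf (y : M) : ∃ g : G, F.leaf y = F.leaf (g • x) := by
  obtain ⟨⟨g, l⟩, rfl⟩ := surjective_leafAction hF x y
  exact ⟨g, leaf_eq_of_mem (smul_mem_leaf hF g l.val_mem)⟩

include hF in
theorem isClosed_leaf_of_isClosed_leaf {y : M} (h : IsClosed (F.leaf y)) :
    IsClosed (F.leaf x) := by
  have : ContinuousSMul G M :=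
    ContMDiffSMul.continuousSMul (I := 𝓘(ℝ, RSpace q)) (I' := 𝓘(ℝ, RSpace (p + q))) ∞
  obtain ⟨g, hg⟩ := exists_smul_mem_leaf hF y x
  rw [hg, ← hF.image_leaf]
  exact (Homeomorph.smul g).isClosedMap _ h

end Action

end Foliation

/-! ### Quotients by discrete and by closed subgroups -/

/-- The projection onto the quotient by a discrete subgroup is a local homeomorphism. -/
theorem QuotientGroup.isLocalHomeomorph_mk_of_discrete {G : Type*} [Group G] [TopologicalSpace G]
    [IsTopologicalGroup G] (H : Subgroup G) [DiscreteTopology H] :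
    IsLocalHomeomorph (QuotientGroup.mk : G → G ⧸ H) := by
  obtain ⟨O, hO, hO1⟩ := isOpen_induced_iff.1 (isOpen_discrete ({1} : Set H))
  have h1O : (1 : G) ∈ O := by
    have : (1 : H) ∈ (Subtype.val ⁻¹' O : Set H) := by rw [hO1]; rfl
    exact this
  apply IsLocalHomeomorph.mk
  intro g
  have hc : ContinuousAt (fun z : G × G => z.1⁻¹ * z.2) (g, g) := by fun_prop
  have hev : ∀ᶠ z : G × G in 𝓝 (g, g), z.1⁻¹ * z.2 ∈ O :=
    hc.eventually_mem (hO.mem_nhds (by simpa using h1O))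
  rw [nhds_prod_eq] at hev
  -- A neighbourhood whose differences `a⁻¹ * b` all lie in `O` contains no two distinct points of
  -- one coset, since `O` meets `H` only in 1.
  obtain ⟨U, hU, hU'⟩ := (Filter.eventually_prod_self_iff
    (r := fun a b : G => a⁻¹ * b ∈ O)).1 hev
  obtain ⟨W, hWU, hW, hgW⟩ := mem_nhds_iff.1 hU
  have hinj : Set.InjOn (QuotientGroup.mk : G → G ⧸ H) W := by
    intro a ha b hb hab
    have h2 : a⁻¹ * b ∈ H := QuotientGroup.eq.1 hab
    have h3 : (⟨_, h2⟩ : H) ∈ (Subtype.val ⁻¹' O : Set H) := hU' a (hWU ha) b (hWU hb)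
    rw [hO1] at h3
    have h4 : a⁻¹ * b = 1 := congrArg Subtype.val h3
    exact inv_mul_eq_one.1 h4
  exact ⟨OpenPartialHomeomorph.ofContinuousOpen (Set.BijOn.toPartialEquiv _ W _ hinj.bijOn_image)
    QuotientGroup.continuous_mk.continuousOn QuotientGroup.isOpenMap_coe hW, hgW, fun _ _ => rfl⟩

/-- For an open quotient map, Hausdorffness means that the equivalence relation is closed; here it
is the preimage of `H` under (a, b) ↦ a⁻¹b. -/
theorem QuotientGroup.t2Space_of_isClosed {G : Type*} [Group G] [TopologicalSpace G]
    [IsTopologicalGroup G] {H : Subgroup G} (hH : IsClosed (H : Set G)) : T2Space (G ⧸ H) := by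
  rw [t2Space_iff_of_isOpenQuotientMap (QuotientGroup.isOpenQuotientMap_mk (N := H))]
  have : {z : G × G | (z.1 : G ⧸ H) = z.2} = (fun z : G × G => z.1⁻¹ * z.2) ⁻¹' (H : Set G) := by
    ext z
    exact QuotientGroup.eq
  rw [this]
  exact hH.preimage (by fun_prop)

/-! ### The diffeomorphism from G ×_H L to M and the fibration over G/H -/

namespace Foliation

variable {p q : ℕ} {M : Type*} [TopologicalSpace M] [ChartedSpace (RSpace (p + q)) M]
  {F : Foliation p q M} {G : Type*} [Group G] [TopologicalSpace G] [ChartedSpace (RSpace q) G]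
  [MulAction G M] (hF : F.IsInvariantTransverse G) (x : M)

/-- If g • l = g' • l', then g'⁻¹g sends one point of L into L; by invariance of the foliation that
suffices for membership in H(L). -/
theorem twistedToManifold_injective : Function.Injective (twistedToManifold hF x) := by
  rintro ⟨a⟩ ⟨b⟩ h
  have h' : a.1 • a.2.val = b.1 • b.2.val := h
  have h1 : (b.1⁻¹ * a.1) • a.2.val = b.2.val := by rw [mul_smul, h', inv_smul_smul]
  refine Quotient.sound ⟨b.1⁻¹ * a.1, ?_, by simp, h1.symm⟩
  rw [mem_leafGroup_iff_exists]
  exact ⟨_, a.2.val_mem, by rw [h1]; exact b.2.val_mem⟩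

variable [ContMDiffSMul 𝓘(ℝ, RSpace q) 𝓘(ℝ, RSpace (p + q)) ∞ G M]
  [LieGroup 𝓘(ℝ, RSpace q) ∞ G] [ConnectedSpace M] [IsManifold 𝓘(ℝ, RSpace (p + q)) ∞ M]

theorem twistedToManifold_bijective : Function.Bijective (twistedToManifold hF x) := by
  refine ⟨twistedToManifold_injective hF x, fun y => ?_⟩
  obtain ⟨a, rfl⟩ := surjective_leafAction hF x y
  exact ⟨Quotient.mk _ a, rfl⟩

/-- The homeomorphism `G ×_H L ≃ M` induced by the action. -/
noncomputable def twistedHomeomorph : TwistedProduct hF x ≃ₜ M :=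
  (Equiv.ofBijective _ (twistedToManifold_bijective hF x)).toHomeomorphOfContinuousOpen
    (continuous_quot_lift _ contMDiff_leafAction.continuous) (by
      intro O hO
      have h : Equiv.ofBijective _ (twistedToManifold_bijective hF x) '' O =
          leafAction (F := F) G x '' (Quotient.mk (twistedSetoid hF x) ⁻¹' O) := by
        ext y
        constructor
        · rintro ⟨⟨a⟩, ha, rfl⟩
          exact ⟨a, ha, rfl⟩
        · rintro ⟨a, ha, rfl⟩
          exact ⟨Quotient.mk _ a, ha, rfl⟩
      rw [h]
      exact hF.isLocalDiffeomorph_leafAction.isOpenMap _ (hO.preimage continuous_quotient_mk'))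

theorem twistedHomeomorph_mk (a : G × F.Leaf x) :
    twistedHomeomorph hF x (Quotient.mk (twistedSetoid hF x) a) = leafAction G x a := rfl

theorem twistedHomeomorph_symm_leafAction (a : G × F.Leaf x) :
    (twistedHomeomorph hF x).symm (leafAction G x a) = Quotient.mk (twistedSetoid hF x) a := by
  rw [← twistedHomeomorph_mk, Homeomorph.symm_apply_apply]

/-- The smooth structure of `G ×_H L`, for which the action induces a diffeomorphism onto `M`. -/
@[reducible]
noncomputable def twistedChartedSpace : ChartedSpace (RSpace (p + q)) (TwistedProduct hF x) :=
  (twistedHomeomorph hF x).symm.isLocalHomeomorph.pushforwardChartedSpace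
    (twistedHomeomorph hF x).symm.surjective

/-- The map pushed forward is a bijection, so the germs relating points of a common fibre can be
taken to be the identity. -/
theorem twisted_isManifold :
    let _ := twistedChartedSpace hF x
    IsManifold 𝓘(ℝ, RSpace (p + q)) ∞ (TwistedProduct hF x) ∧
      IsLocalDiffeomorph 𝓘(ℝ, RSpace (p + q)) 𝓘(ℝ, RSpace (p + q)) ∞
        (twistedHomeomorph hF x).symm :=
  (twistedHomeomorph hF x).symm.isLocalHomeomorph.pushforward_isManifold _ fun _ _ hab =>
    ⟨id, contMDiffAt_id, (twistedHomeomorph hF x).symm.injective hab,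
      Filter.Eventually.of_forall fun _ => rfl⟩

theorem exists_twistedDiffeomorph :
    let _ := twistedChartedSpace hF x
    ∃ Ψ : TwistedProduct hF x ≃ₘ^∞⟮𝓘(ℝ, RSpace (p + q)), 𝓘(ℝ, RSpace (p + q))⟯ M,
      ⇑Ψ = twistedToManifold hF x ∧
      ∀ a, Ψ.symm (leafAction G x a) = Quotient.mk (twistedSetoid hF x) a := by
  let _ := twistedChartedSpace hF x
  have hl := (twisted_isManifold hF x).2
  set e := twistedHomeomorph hF x with he
  obtain ⟨Φ, h1, h2, h3⟩ := exists_partialDiffeomorph_of_injOn isOpen_univ (fun y _ => hl y)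
    e.symm.injective.injOn ⟨x⟩
  refine ⟨⟨e.toEquiv, ?_, hl.contMDiff⟩, rfl, twistedHomeomorph_symm_leafAction hF x⟩
  rw [← contMDiffOn_univ]
  have h4 : Φ.target = Set.univ := by rw [h2, Set.image_univ, e.symm.surjective.range_eq]
  have h5 := Φ.symm.contMDiffOn
  change ContMDiffOn _ _ _ _ Φ.target at h5
  rw [h4] at h5
  refine h5.congr fun y _ => ?_
  have h6 : Φ (e y) = y := by rw [← h3 trivial]; exact e.symm_apply_apply y
  have h7 : Φ.symm (Φ (e y)) = e y := Φ.left_inv (by rw [h1]; trivial)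
  rw [h6] at h7
  exact h7.symm

/-- The fibre bundle structure of the projection `M → G ⧸ H`. -/
theorem isSmoothFibreBundle_of_leafAction [ChartedSpace (RSpace q) (G ⧸ leafGroup hF x)]
    (hπ : IsLocalDiffeomorph 𝓘(ℝ, RSpace q) 𝓘(ℝ, RSpace q) ∞
      (QuotientGroup.mk : G → G ⧸ leafGroup hF x)) {P : M → G ⧸ leafGroup hF x}
    (hP : ∀ a, P (leafAction (F := F) G x a) = (a.1 : G ⧸ leafGroup hF x)) :
    IsSmoothFibreBundle (d := p + q) (e := p) (k := q) (F.Leaf x) P := by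
  have hμ : IsLocalDiffeomorph (𝓘(ℝ, RSpace q).prod 𝓘(ℝ, RSpace p)) 𝓘(ℝ, RSpace (p + q)) ∞
      (leafAction (F := F) G x) := hF.isLocalDiffeomorph_leafAction
  have hsmooth : ContMDiff 𝓘(ℝ, RSpace (p + q)) 𝓘(ℝ, RSpace q) ∞ P := by
    intro y
    obtain ⟨a, rfl⟩ := surjective_leafAction hF x y
    obtain ⟨Φ, ha, hΦ⟩ := hμ a
    have hy : leafAction G x a ∈ Φ.target := by rw [hΦ ha]; exact Φ.map_source ha
    have h1 : ContMDiffAt 𝓘(ℝ, RSpace (p + q)) (𝓘(ℝ, RSpace q).prod 𝓘(ℝ, RSpace p)) ∞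
      Φ.symm (leafAction G x a) := Φ.symm.contMDiffOn.contMDiffAt (Φ.open_target.mem_nhds hy)
    refine ((hπ.contMDiff.comp contMDiff_fst).contMDiffAt.comp _ h1).congr_of_eventuallyEq ?_
    filter_upwards [Φ.open_target.mem_nhds hy] with z hz
    have h2 : leafAction G x (Φ.symm z) = z :=
      (hΦ (Φ.map_target hz)).trans (Φ.right_inv hz)
    change P z = (Φ.symm z).1
    rw [← hP, h2]
  refine ⟨hsmooth, fun b => ?_⟩
  obtain ⟨g, rfl⟩ := QuotientGroup.mk_surjective b
  obtain ⟨σ, hg, hσ⟩ := hπ g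
  -- The image under `P` determines the coset of `u`, and `σ` is injective on its source, so `u` and
  -- then `l` are determined.
  have hinj : Set.InjOn (leafAction (F := F) G x) (σ.source ×ˢ Set.univ) := by
    rintro ⟨u, l⟩ ⟨hu, -⟩ ⟨u', l'⟩ ⟨hu', -⟩ h
    have h1 : σ u = σ u' := by
      rw [← hσ hu, ← hσ hu']
      have := congrArg P h
      rwa [hP, hP] at this
    obtain rfl : u = u' := σ.injOn hu hu' h1
    have h2 : u • l.val = u • l'.val := h
    exact Prod.ext rfl (Leaf.val_injective (smul_left_cancel u h2))
  obtain ⟨Φ, h1, h2, h3⟩ := exists_partialDiffeomorph_of_injOn (σ.open_source.prod isOpen_univ)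
    (fun a _ => hμ a) hinj ⟨(g, Leaf.mk x (mem_leaf_self x))⟩
  have hσ' : ∀ b ∈ σ.target, ((σ.symm b : G) : G ⧸ leafGroup hF x) = b := by
    intro b hb
    exact (hσ (σ.map_target hb)).trans (σ.right_inv hb)
  have htarget : Φ.target = P ⁻¹' σ.target := by
    rw [h2]
    ext y
    constructor
    · rintro ⟨⟨u, l⟩, ⟨hu, -⟩, rfl⟩
      rw [Set.mem_preimage, hP, hσ hu]
      exact σ.map_source hu
    · intro hy
      obtain ⟨⟨u', l'⟩, rfl⟩ := surjective_leafAction hF x y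
      rw [Set.mem_preimage, hP] at hy
      set u := σ.symm (u' : G ⧸ leafGroup hF x) with hu
      have h4 : u⁻¹ * u' ∈ leafGroup hF x := QuotientGroup.eq.1 (hσ' _ hy)
      -- The representative `u'` of the coset is replaced by the one in `σ.source`; the discrepancy
      -- u⁻¹u' lies in H and is absorbed by the leaf.
      refine ⟨(u, Leaf.mk ((u⁻¹ * u') • l'.val) (h4 _ l'.val_mem)), ⟨σ.map_target hy, trivial⟩, ?_⟩
      change u • (u⁻¹ * u') • l'.val = u' • l'.val
      rw [smul_smul, mul_inv_cancel_left]
  have hΦr : ∀ y ∈ Φ.target, Φ.symm y ∈ σ.source ×ˢ (Set.univ : Set (F.Leaf x)) ∧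
      leafAction G x (Φ.symm y) = y := by
    intro y hy
    have h4 : Φ.symm y ∈ Φ.source := Φ.map_target hy
    rw [h1] at h4
    exact ⟨h4, (h3 h4).trans (Φ.right_inv hy)⟩
  have hΦl : ∀ b ∈ σ.target, ∀ l : F.Leaf x,
      Φ.symm (leafAction G x (σ.symm b, l)) = (σ.symm b, l) := by
    intro b hb l
    have h4 : (σ.symm b, l) ∈ σ.source ×ˢ (Set.univ : Set (F.Leaf x)) :=
      ⟨σ.map_target hb, trivial⟩
    rw [h3 h4]
    exact Φ.left_inv (by rw [h1]; exact h4)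
  have hto : ContMDiffOn 𝓘(ℝ, RSpace (p + q)) (𝓘(ℝ, RSpace q).prod 𝓘(ℝ, RSpace p)) ∞
      (fun y => (P y, (Φ.symm y).2)) (P ⁻¹' σ.target) := by
    refine hsmooth.contMDiffOn.prodMk ?_
    rw [← htarget]
    exact contMDiff_snd.comp_contMDiffOn Φ.symm.contMDiffOn
  have hinv : ContMDiffOn (𝓘(ℝ, RSpace q).prod 𝓘(ℝ, RSpace p)) 𝓘(ℝ, RSpace (p + q)) ∞
      (fun z : (G ⧸ leafGroup hF x) × F.Leaf x => leafAction G x (σ.symm z.1, z.2))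
      (σ.target ×ˢ Set.univ) :=
    contMDiff_leafAction.comp_contMDiffOn
      ((σ.symm.contMDiffOn.comp contMDiffOn_fst fun z hz => hz.1).prodMk contMDiffOn_snd)
  refine ⟨{ toFun := fun y => (P y, (Φ.symm y).2)
            invFun := fun z => leafAction G x (σ.symm z.1, z.2)
            source := P ⁻¹' σ.target
            target := σ.target ×ˢ Set.univ
            map_source' := fun y hy => ⟨hy, trivial⟩
            map_target' := fun z hz => ?_
            left_inv' := fun y hy => ?_
            right_inv' := fun z hz => ?_
            open_source := σ.open_target.preimage hsmooth.continuous
            open_target := σ.open_target.prod isOpen_univ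
            continuousOn_toFun := hto.continuousOn
            continuousOn_invFun := hinv.continuousOn
            baseSet := σ.target
            open_baseSet := σ.open_target
            source_eq := rfl
            target_eq := rfl
            proj_toFun := fun _ _ => rfl }, ?_, hto, hinv⟩
  · rw [Set.mem_preimage, hP, hσ' _ hz.1]
    exact hz.1
  · have hy' := hΦr y (by rw [htarget]; exact hy)
    have h4 : σ.symm (P y) = (Φ.symm y).1 := by
      have h5 : P y = σ (Φ.symm y).1 := by
        rw [← hσ hy'.1.1, ← hP, hy'.2]
      rw [h5]
      exact σ.left_inv hy'.1.1
    change leafAction G x (σ.symm (P y), (Φ.symm y).2) = y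
    rw [h4]
    exact hy'.2
  · refine Prod.ext ((hP _).trans (hσ' _ hz.1)) ?_
    change (Φ.symm (leafAction G x (σ.symm z.1, z.2))).2 = z.2
    rw [hΦl z.1 hz.1]
  · change (g : G ⧸ leafGroup hF x) ∈ σ.target
    rw [hσ hg]
    exact σ.map_source hg

omit [ContMDiffSMul 𝓘(ℝ, RSpace q) 𝓘(ℝ, RSpace (p + q)) ∞ G M]
  [LieGroup 𝓘(ℝ, RSpace q) ∞ G] [ConnectedSpace M] [IsManifold 𝓘(ℝ, RSpace (p + q)) ∞ M] in
theorem mk_eq_mk_iff (g g' : G) :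
    (g : G ⧸ leafGroup hF x) = g' ↔ F.leaf (g • x) = F.leaf (g' • x) := by
  rw [QuotientGroup.eq, mem_leafGroup_iff]
  constructor
  · intro h
    have h1 := smul_mem_leaf hF g h
    rw [smul_smul, mul_inv_cancel_left] at h1
    exact (leaf_eq_of_mem h1).symm
  · intro h
    have h1 : g' • x ∈ F.leaf (g • x) := by rw [h]; exact mem_leaf_self _
    rw [← hF.image_leaf] at h1
    obtain ⟨y, hy, hy'⟩ := h1
    have h2 : y = (g⁻¹ * g') • x := by rw [mul_smul, ← hy', inv_smul_smul]
    rwa [← h2]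

/-- Every point is g' • l with l in L, hence lies in the leaf of g' • x, and cosets of H(L)
correspond to translates of L. -/
theorem preimage_eq_leaf {P : M → G ⧸ leafGroup hF x}
    (hP : ∀ a, P (leafAction (F := F) G x a) = (a.1 : G ⧸ leafGroup hF x)) (g : G) :
    P ⁻¹' {(g : G ⧸ leafGroup hF x)} = F.leaf (g • x) := by
  ext y
  obtain ⟨⟨g', l⟩, rfl⟩ := surjective_leafAction hF x y
  have h1 : F.leaf (leafAction G x (g', l)) = F.leaf (g' • x) :=
    leaf_eq_of_mem (smul_mem_leaf hF g' l.val_mem)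
  rw [Set.mem_preimage, hP, Set.mem_singleton_iff, mk_eq_mk_iff, ← h1]
  constructor
  · intro h
    rw [← h]
    exact mem_leaf_self _
  · exact leaf_eq_of_mem

theorem range_preimage_eq_leaves {P : M → G ⧸ leafGroup hF x}
    (hP : ∀ a, P (leafAction (F := F) G x a) = (a.1 : G ⧸ leafGroup hF x)) :
    Set.range (fun b => P ⁻¹' {b}) = F.leaves := by
  ext L
  constructor
  · rintro ⟨b, rfl⟩
    obtain ⟨g, rfl⟩ := QuotientGroup.mk_surjective b
    exact ⟨g • x, (preimage_eq_leaf hF x hP g).symm⟩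
  · rintro ⟨y, rfl⟩
    obtain ⟨g, hg⟩ := exists_smul_mem_leaf hF x y
    exact ⟨g, (preimage_eq_leaf hF x hP g).trans hg.symm⟩

theorem inducesFibration [SecondCountableTopology M]
    (hcl : IsClosed (leafGroup hF x : Set G)) (hd : DiscreteTopology (leafGroup hF x)) :
    InducesFibration hF x := by
  have := (LieGroup.isTopologicalGroup_and_t2Space q G).1
  have hπ := QuotientGroup.isLocalHomeomorph_mk_of_discrete (leafGroup hF x)
  have hs : Function.Surjective (QuotientGroup.mk : G → G ⧸ leafGroup hF x) :=
    QuotientGroup.mk_surjective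
  let c₁ : ChartedSpace (RSpace q) (G ⧸ leafGroup hF x) := hπ.pushforwardChartedSpace hs
  let c₂ := twistedChartedSpace hF x
  -- Two points `a`, `b` of one coset are related by right translation by a⁻¹b, an element of H,
  -- which is smooth and preserves cosets.
  obtain ⟨hm₁, hl₁⟩ := hπ.pushforward_isManifold (E := RSpace q) hs fun a b hab =>
    ⟨fun z => z * (a⁻¹ * b), contMDiff_mul_right.contMDiffAt, by simp,
      Filter.Eventually.of_forall fun z => (QuotientGroup.mk_mul_of_mem z (QuotientGroup.eq.1 hab))⟩
  obtain ⟨hm₂, hl₂⟩ := twisted_isManifold hF x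
  obtain ⟨Ψ, hΨ, hΨs⟩ := exists_twistedDiffeomorph hF x
  have hP : ∀ a, twistedProj hF x (Ψ.symm (leafAction (F := F) G x a)) =
      (a.1 : G ⧸ leafGroup hF x) := by
    intro a
    rw [hΨs]
    rfl
  have hbundle := isSmoothFibreBundle_of_leafAction hF x hl₁
    (P := fun y => twistedProj hF x (Ψ.symm y)) hP
  have hPs : Function.Surjective fun y => twistedProj hF x (Ψ.symm y) := by
    intro b
    obtain ⟨g, rfl⟩ := QuotientGroup.mk_surjective b
    exact ⟨_, hP (g, Leaf.mk x (mem_leaf_self x))⟩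
  -- Second countability of G/H is inherited from M, not from G: the projection M → G/H is an open
  -- continuous surjection.
  have hPo : IsOpenMap fun y => twistedProj hF x (Ψ.symm y) := by
    intro O hO
    have h : (fun y => twistedProj hF x (Ψ.symm y)) '' O =
        QuotientGroup.mk '' (Prod.fst '' (leafAction (F := F) G x ⁻¹' O)) := by
      ext b
      constructor
      · rintro ⟨y, hy, rfl⟩
        obtain ⟨a, rfl⟩ := surjective_leafAction hF x y
        exact ⟨a.1, ⟨a, hy, rfl⟩, (hP a).symm⟩
      · rintro ⟨_, ⟨a, ha, rfl⟩, rfl⟩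
        exact ⟨_, ha, hP a⟩
    rw [h]
    exact QuotientGroup.isOpenMap_coe _
      (isOpenMap_fst _ (hO.preimage contMDiff_leafAction.continuous))
  refine ⟨c₁, c₂, QuotientGroup.t2Space_of_isClosed hcl,
    (hPo.isQuotientMap hbundle.1.continuous hPs).secondCountableTopology hPo, hm₁, hl₁.contMDiff,
    fun g => ?_, hm₂, ?_, Ψ, hΨ, hbundle, range_preimage_eq_leaves hF x hP⟩
  · rw [← IsLocalDiffeomorphAt.mfderivToContinuousLinearEquiv_coe (hl₁ g) (by simp)]
    exact ((hl₁ g).mfderivToContinuousLinearEquiv (by simp)).surjective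
  · intro a
    have h := (hF.isLocalDiffeomorph_leafAction a).comp _ _ (hl₂ _)
    -- The quotient map is the action map followed by the inverse of the identification with M,
    -- hence a composite of local diffeomorphisms.
    have he : (fun a : G × F.Leaf x => Quotient.mk (twistedSetoid hF x) a) =
        (twistedHomeomorph hF x).symm ∘ leafAction G x :=
      funext fun a => (twistedHomeomorph_symm_leafAction hF x a).symm
    rw [he]
    exact h

omit [ContMDiffSMul 𝓘(ℝ, RSpace q) 𝓘(ℝ, RSpace (p + q)) ∞ G M]
  [LieGroup 𝓘(ℝ, RSpace q) ∞ G] [ConnectedSpace M] [IsManifold 𝓘(ℝ, RSpace (p + q)) ∞ M] in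
variable {hF x} in
theorem InducesFibration.isClosed_leaf (h : InducesFibration hF x) : IsClosed (F.leaf x) := by
  obtain ⟨_, _, hT2, -, -, -, -, -, -, Ψ, -, hb, hr⟩ := h
  have hx : F.leaf x ∈ F.leaves := ⟨x, rfl⟩
  rw [← hr] at hx
  obtain ⟨b, hb'⟩ := hx
  rw [← hb']
  exact isClosed_singleton.preimage hb.1.continuous

end Foliation

theorem theorem2 {p q : ℕ}
    {M : Type*} [TopologicalSpace M] [T2Space M] [SecondCountableTopology M] [ConnectedSpace M]
    [ChartedSpace (RSpace (p + q)) M] [IsManifold 𝓘(ℝ, RSpace (p + q)) ∞ M]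
    {G : Type*} [Group G] [TopologicalSpace G] [ChartedSpace (RSpace q) G]
    [LieGroup 𝓘(ℝ, RSpace q) ∞ G]
    [MulAction G M] [ContMDiffSMul 𝓘(ℝ, RSpace q) 𝓘(ℝ, RSpace (p + q)) ∞ G M]
    (F : Foliation p q M) (hF : F.IsInvariantTransverse G) (x : M) :
    List.TFAE [
      ∃ L ∈ F.leaves, IsClosed L,
      IsClosed (F.leaf x),
      IsClosed (Foliation.leafGroup hF x : Set G) ∧ DiscreteTopology (Foliation.leafGroup hF x),
      Foliation.InducesFibration hF x] := by
  have : ContinuousSMul G M :=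
    ContMDiffSMul.continuousSMul (I := 𝓘(ℝ, RSpace q)) (I' := 𝓘(ℝ, RSpace (p + q))) ∞
  tfae_have 1 → 2 := by
    rintro ⟨_, ⟨y, rfl⟩, h⟩
    exact Foliation.isClosed_leaf_of_isClosed_leaf hF x h
  tfae_have 2 → 1 := fun h => ⟨_, ⟨x, rfl⟩, h⟩
  tfae_have 2 → 3 := fun h =>
    ⟨Foliation.isClosed_leafGroup hF x h, Foliation.discreteTopology_leafGroup hF x h⟩
  tfae_have 3 → 4 := fun h => Foliation.inducesFibration hF x h.1 h.2
  tfae_have 4 → 2 := Foliation.InducesFibration.isClosed_leaf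
  tfae_finish
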